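/- Let $0<b\le a$, let $\mathsf A=\{(x_1,x_2)\in\mathbb R^2 : x_1^2/a^2+x_2^2/b^2<1\}$ be the open elliptic disk with semi-axes $a,b$, let $\varepsilon=\sqrt{1-b^2/a^2}$ be its eccentricity, and put $$K(e)=\int_0^{\pi/2}\frac{d\varphi}{\sqrt{1-e^2\sin^2\varphi}},\qquad D(e)=\int_0^{\pi/2}\frac{\sin^2\varphi}{\sqrt{1-e^2\sin^2\varphi}}\,d\varphi ,$$ so that $K(0)=\pi/2$ and $D(0)=\pi/4$. Define on $\mathsf A$ the source densities $$\rho_w(x_1,x_2)=\frac{1}{b\,K(\varepsilon)}\,\frac{1}{\sqrt{1-x_1^2/a^2-x_2^2/b^2}},\qquad \rho_t(x_1,x_2)=\frac{1}{b\,D(\varepsilon)}\,\frac{x_1}{\sqrt{1-x_1^2/a^2-x_2^2/b^2}},$$ and let $w,t:\mathbb R^3\to\mathbb R$ be the potentials they generate, $$w(x)=\frac1{2\pi}\int_{\mathsf A}\frac{\rho_w(y)}{|x-(y,0)|}\,dy,\qquad t(x)=\frac1{2\pi}\int_{\mathsf A}\frac{\rho_t(y)}{|x-(y,0)|}\,dy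 .$$ Then: 1. For every $x=(x_1,x_2)\in\mathsf A$ the integrals $\frac1{2\pi}\int_{\mathsf A}\frac{\rho_w(y)}{|x-y|}\,dy$ and $\frac1{2\pi}\int_{\mathsf A}\frac{\rho_t(y)}{|x-y|}\,dy$ converge absolutely and are equal to $1$ and to $x_1$, respectively. 2. Both $f=w$ and $f=t$ are harmonic in $\{x_3\ne0\}$, satisfy $\partial_{x_3}f(x',0)=0$ for $x'\notin\overline{\mathsf A}$, are continuous at the points of $\mathsf A\times\{0\}$, and there $w(x',0)=1$ and $t(x',0)=x_1$. 3. In each of the half-spaces $\{x_3>0\}$ and $\{x_3<0\}$ the Dirichlet energies are finite, and $$\int_{\pm x_3>0}|\nabla w|^2\,dx=4a\,\frac{K(0)}{K(\varepsilon)}\ \Bigl(=\frac{2\pi a}{K(\varepsilon)}\Bigr),\qquad \int_{\pm x_3>0}|\nabla t|^2\,dx=\frac83\,a^3\,\frac{D(0)}{D(\varepsilon)} .$$ -/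

import Mathlib

open scoped Gradient

noncomputable section

namespace EllipticAperture

/-- The elliptic disk with semi-axes `a` and `b`, as an open subset of the Euclidean plane. -/
def ellipticDisk (a b : ℝ) : Set (EuclideanSpace ℝ (Fin 2)) :=
  {y | y 0 ^ 2 / a ^ 2 + y 1 ^ 2 / b ^ 2 < 1}

/-- The eccentricity of the ellipse with semi-axes `a ≥ b`. -/
def eccentricity (a b : ℝ) : ℝ := Real.sqrt (1 - b ^ 2 / a ^ 2)

/-- The complete elliptic integral of the first kind, as a function of the eccentricity. -/
def ellipticK (ε : ℝ) : ℝ :=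
  ∫ φ in (0 : ℝ)..(Real.pi / 2), 1 / Real.sqrt (1 - ε ^ 2 * Real.sin φ ^ 2)

/-- The complete elliptic integral `D`, as a function of the eccentricity. -/
def ellipticD (ε : ℝ) : ℝ :=
  ∫ φ in (0 : ℝ)..(Real.pi / 2), Real.sin φ ^ 2 / Real.sqrt (1 - ε ^ 2 * Real.sin φ ^ 2)

/-- The point of Euclidean 3-space above the point `y` of the plane, at height `s`. -/
def lift3 (y : EuclideanSpace ℝ (Fin 2)) (s : ℝ) : EuclideanSpace ℝ (Fin 3) :=
  !₂[y 0, y 1, s]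

/-- The potential at `x` in 3-space generated by the source density `ρ` on the subset `A` of the
plane `x₃ = 0`, normalised by `1 / (2 π)`. -/
def singleLayer (A : Set (EuclideanSpace ℝ (Fin 2))) (ρ : EuclideanSpace ℝ (Fin 2) → ℝ)
    (x : EuclideanSpace ℝ (Fin 3)) : ℝ :=
  1 / (2 * Real.pi) * ∫ y in A, ρ y / ‖x - lift3 y 0‖

/-- The source density of the potential that is constant on the elliptic disk. -/
def rhoW (a b : ℝ) (y : EuclideanSpace ℝ (Fin 2)) : ℝ :=
  1 / (b * ellipticK (eccentricity a b) * Real.sqrt (1 - y 0 ^ 2 / a ^ 2 - y 1 ^ 2 / b ^ 2))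

/-- The source density of the potential that is equal to `x₁` on the elliptic disk. -/
def rhoT (a b : ℝ) (y : EuclideanSpace ℝ (Fin 2)) : ℝ :=
  y 0 / (b * ellipticD (eccentricity a b) * Real.sqrt (1 - y 0 ^ 2 / a ^ 2 - y 1 ^ 2 / b ^ 2))

/-- The potential generated by `rhoW` on the elliptic disk. -/
def potW (a b : ℝ) : EuclideanSpace ℝ (Fin 3) → ℝ :=
  singleLayer (ellipticDisk a b) (rhoW a b)

/-- The potential generated by `rhoT` on the elliptic disk. -/
def potT (a b : ℝ) : EuclideanSpace ℝ (Fin 3) → ℝ :=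
  singleLayer (ellipticDisk a b) (rhoT a b)

/-- The upper open half-space `x₃ > 0`. -/
def upperHalfSpace : Set (EuclideanSpace ℝ (Fin 3)) := {x | 0 < x 2}

/-- The lower open half-space `x₃ < 0`. -/
def lowerHalfSpace : Set (EuclideanSpace ℝ (Fin 3)) := {x | x 2 < 0}

/-- `f` has finite Dirichlet energy on `U`, and this energy is equal to `I`. -/
def HasDirichletEnergy (f : EuclideanSpace ℝ (Fin 3) → ℝ) (U : Set (EuclideanSpace ℝ (Fin 3)))
    (I : ℝ) : Prop :=
  MeasureTheory.IntegrableOn (fun x => ‖∇ f x‖ ^ 2) U ∧ ∫ x in U, ‖∇ f x‖ ^ 2 = I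

/-- `f` solves the mixed boundary value problem of an aperture `A` in the plane `x₃ = 0`, with
Dirichlet data `g` on `A`: it is harmonic off the plane, its normal derivative vanishes on the
plane outside the closed aperture, and on `A` it is equal to `g`, also as a limit from space. -/
structure SolvesApertureProblem (A : Set (EuclideanSpace ℝ (Fin 2)))
    (g : EuclideanSpace ℝ (Fin 2) → ℝ) (f : EuclideanSpace ℝ (Fin 3) → ℝ) : Prop where
  harmonic : InnerProductSpace.HarmonicOnNhd f {x | x 2 ≠ 0}
  neumann : ∀ y ∉ closure A, HasDerivAt (fun s : ℝ => f (lift3 y s)) 0 0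
  continuousAt : ∀ y ∈ A, ContinuousAt f (lift3 y 0)
  dirichlet : ∀ y ∈ A, f (lift3 y 0) = g y

end EllipticAperture

end

/-!
In the coordinates `y = x + h (u, 1)` centred at a point `x` of the ellipse the Jacobian `|h|`
cancels the singularity of `1 / |x - y|`. Along the chord of slope parameter `u` the profile
`(1 - y₁² / a² - y₂² / b²)^(-1/2)` is the inverse square root of a quadratic polynomial, so its
integral over the chord is `π (u² / a² + 1 / b²)^(-1/2)`, whatever `x` is; with an additional
factor `y₁` it is the same multiple of the first coordinate of the midpoint of the chord, whose part
even in `u` is a multiple of `x₁`. The remaining integrals over `u` become `K` and `D` under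
`u = tan φ`.

For the energy, `|∇f|²` is a double superposition over pairs of sources `y`, `z` of inner products
of gradients of Newton kernels. On the rays from `y` such an inner product is, up to sign, the
radial derivative of the kernel of `z` divided by the square of the distance to `y`, which the
volume element cancels, so that integration over a half-space gives `2π / |y - z|`. By Fubini's
theorem the energy is then the integral of the density against its own potential in the plane, a
moment of the profile.
-/

noncomputable section

namespace EllipticAperture

open MeasureTheory Set Filter Topology

section ChordIntegrals

theorem inv_sqrt_one_sub_sq_eq_zero {s : ℝ} (hs : 1 ≤ |s|) : (√(1 - s ^ 2))⁻¹ = 0 := by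
  rw [Real.sqrt_eq_zero_of_nonpos (by linarith [(one_le_sq_iff_one_le_abs s).2 hs]), inv_zero]

theorem hasDerivAt_arcsin_of_abs_lt_one {s : ℝ} (hs : |s| < 1) :
    HasDerivAt Real.arcsin (√(1 - s ^ 2))⁻¹ s := by
  simpa only [one_div] using
    Real.hasDerivAt_arcsin (abs_lt.1 hs).1.ne' (abs_lt.1 hs).2.ne

theorem inv_sqrt_one_sub_sq_eq_zero_of_notMem_Ioc {s : ℝ} (hs : s ∉ Ioc (-1 : ℝ) 1) :
    (√(1 - s ^ 2))⁻¹ = 0 :=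
  inv_sqrt_one_sub_sq_eq_zero <| by
    by_contra! h
    exact hs ⟨(abs_lt.1 h).1, (abs_lt.1 h).2.le⟩

theorem integrable_inv_sqrt_one_sub_sq : Integrable fun s : ℝ => (√(1 - s ^ 2))⁻¹ :=
  (intervalIntegral.integrableOn_deriv_of_nonneg Real.continuous_arcsin.continuousOn
    (fun _ hs => hasDerivAt_arcsin_of_abs_lt_one (abs_lt.2 hs))
    (fun _ _ => by positivity)).integrable_of_forall_notMem_eq_zero
    fun _ => inv_sqrt_one_sub_sq_eq_zero_of_notMem_Ioc

theorem integral_inv_sqrt_one_sub_sq : ∫ s : ℝ, (√(1 - s ^ 2))⁻¹ = Real.pi := by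
  rw [← setIntegral_eq_integral_of_forall_compl_eq_zero
      fun _ => inv_sqrt_one_sub_sq_eq_zero_of_notMem_Ioc,
    ← intervalIntegral.integral_of_le (by norm_num),
    intervalIntegral.integral_eq_sub_of_hasDerivAt_of_le (by norm_num)
      Real.continuous_arcsin.continuousOn
      (fun _ hs => hasDerivAt_arcsin_of_abs_lt_one (abs_lt.2 hs))
      integrable_inv_sqrt_one_sub_sq.intervalIntegrable,
    Real.arcsin_one, Real.arcsin_neg_one]
  ring

theorem integrable_mul_inv_sqrt_one_sub_sq : Integrable fun s : ℝ => s * (√(1 - s ^ 2))⁻¹ := by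
  refine integrable_inv_sqrt_one_sub_sq.mono (by fun_prop) (.of_forall fun s => ?_)
  rcases le_total |s| 1 with hs | hs
  · exact (norm_mul _ _).trans_le (mul_le_of_le_one_left (norm_nonneg _) hs)
  · rw [inv_sqrt_one_sub_sq_eq_zero hs, mul_zero]

variable {M q : ℝ}

theorem inv_sqrt_sub_mul_sq (hM : 0 < M) (hq : 0 < q) (m h : ℝ) :
    (√(M - q * (h - m) ^ 2))⁻¹ =
      (√M)⁻¹ * (√(1 - (√(q / M) * (h - m)) ^ 2))⁻¹ := by
  rw [← mul_inv, ← Real.sqrt_mul hM.le, mul_pow, Real.sq_sqrt (by positivity)]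
  congr 2
  field_simp

theorem integrable_inv_sqrt_sub_mul_sq (hM : 0 < M) (hq : 0 < q) (m : ℝ) :
    Integrable fun h : ℝ => (√(M - q * (h - m) ^ 2))⁻¹ := by
  simp_rw [inv_sqrt_sub_mul_sq hM hq]
  have hscale : √(q / M) ≠ 0 := by positivity
  exact ((integrable_inv_sqrt_one_sub_sq.comp_mul_left' hscale).comp_sub_right m).const_mul _

theorem integral_inv_sqrt_sub_mul_sq (hM : 0 < M) (hq : 0 < q) (m : ℝ) :
    ∫ h : ℝ, (√(M - q * (h - m) ^ 2))⁻¹ = Real.pi / √q := by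
  simp_rw [inv_sqrt_sub_mul_sq hM hq]
  rw [integral_const_mul,
    integral_sub_right_eq_self (fun h : ℝ => (√(1 - (√(q / M) * h) ^ 2))⁻¹) m,
    Measure.integral_comp_mul_left (fun h : ℝ => (√(1 - h ^ 2))⁻¹),
    integral_inv_sqrt_one_sub_sq, Real.sqrt_div hq.le, abs_of_pos (by positivity), smul_eq_mul]
  have := Real.sqrt_pos.2 hM
  have := Real.sqrt_pos.2 hq
  field_simp

theorem integrable_sub_mul_inv_sqrt_sub_mul_sq (hM : 0 < M) (hq : 0 < q) (m : ℝ) :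
    Integrable fun h : ℝ => (h - m) * (√(M - q * (h - m) ^ 2))⁻¹ := by
  have hscale : √(q / M) ≠ 0 := by positivity
  refine (((integrable_mul_inv_sqrt_one_sub_sq.comp_mul_left' hscale).comp_sub_right m).const_mul
    ((√M)⁻¹ * (√(q / M))⁻¹)).congr (.of_forall fun h => ?_)
  simp only [inv_sqrt_sub_mul_sq hM hq]
  field_simp

theorem integral_eq_zero_of_odd {g : ℝ → ℝ} (hg : g.Odd) : ∫ s, g s = 0 := by
  refine self_eq_neg.1 ?_
  rw [← integral_neg, ← integral_neg_eq_self]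
  simp only [hg _]

theorem integral_affine_mul_inv_sqrt_sub_mul_sq (hM : 0 < M) (hq : 0 < q) (m α β : ℝ) :
    ∫ h : ℝ, (α + β * h) * (√(M - q * (h - m) ^ 2))⁻¹ = (α + β * m) * (Real.pi / √q) := by
  have hodd : ∫ h : ℝ, (h - m) * (√(M - q * (h - m) ^ 2))⁻¹ = 0 := by
    rw [integral_sub_right_eq_self (fun h : ℝ => h * (√(M - q * h ^ 2))⁻¹) m]
    exact integral_eq_zero_of_odd fun h => by rw [neg_sq, neg_mul]
  calc ∫ h : ℝ, (α + β * h) * (√(M - q * (h - m) ^ 2))⁻¹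
      = ∫ h : ℝ, ((α + β * m) * (√(M - q * (h - m) ^ 2))⁻¹ +
          β * ((h - m) * (√(M - q * (h - m) ^ 2))⁻¹)) := by congr with h; ring
    _ = _ := by
      rw [integral_add ((integrable_inv_sqrt_sub_mul_sq hM hq m).const_mul _)
        ((integrable_sub_mul_inv_sqrt_sub_mul_sq hM hq m).const_mul _), integral_const_mul,
        integral_const_mul, hodd, integral_inv_sqrt_sub_mul_sq hM hq, mul_zero, add_zero]

theorem integral_affine_mul_of_even {w : ℝ → ℝ} (hw : w.Even) {A B : ℝ}
    (hi : Integrable fun u => (A + B * u) * w u) :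
    ∫ u, (A + B * u) * w u = A * ∫ u, w u := by
  have hreflect : ∫ u, (A - B * u) * w u = ∫ u, (A + B * u) * w u := by
    rw [← integral_neg_eq_self]
    simp only [hw _, mul_neg, sub_neg_eq_add]
  have hi' : Integrable fun u => (A - B * u) * w u := by
    simpa only [hw _, mul_neg, ← sub_eq_add_neg] using hi.comp_neg
  have hsum := integral_add hi hi'
  rw [hreflect] at hsum
  have : ∫ u, ((A + B * u) * w u + (A - B * u) * w u) = 2 * (A * ∫ u, w u) := by
    rw [← integral_const_mul, ← integral_const_mul]
    congr with u
    ring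
  linarith

end ChordIntegrals

section EllipticIntegrals

theorem integral_eq_setIntegral_tan {F : Type*} [NormedAddCommGroup F] [NormedSpace ℝ F]
    (g : ℝ → F) :
    ∫ u, g u = ∫ φ in Ioo (-(Real.pi / 2)) (Real.pi / 2), (Real.cos φ ^ 2)⁻¹ • g (Real.tan φ) := by
  rw [← setIntegral_univ, ← Real.image_tan_Ioo,
    integral_image_eq_integral_abs_deriv_smul (f' := fun φ => (Real.cos φ ^ 2)⁻¹)
      measurableSet_Ioo (fun φ hφ => ?_) Real.injOn_tan]
  · simp only [abs_inv, abs_sq]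
  · simpa only [one_div] using
      (Real.hasDerivAt_tan (Real.cos_pos_of_mem_Ioo hφ).ne').hasDerivWithinAt

theorem setIntegral_Ioo_neg_self_of_even {g : ℝ → ℝ} (hg : Continuous g) (heven : g.Even) {c : ℝ}
    (hc : 0 ≤ c) : ∫ φ in Ioo (-c) c, g φ = 2 * ∫ φ in (0 : ℝ)..c, g φ := by
  have hreflect : ∫ φ in -c..0, g φ = ∫ φ in (0 : ℝ)..c, g φ := by
    simpa only [heven _, neg_zero] using
      (intervalIntegral.integral_comp_neg (a := 0) (b := c) g).symm
  rw [← integral_Ioc_eq_integral_Ioo, ← intervalIntegral.integral_of_le (by linarith),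
    ← intervalIntegral.integral_add_adjacent_intervals (b := 0) (hg.intervalIntegrable _ _)
      (hg.intervalIntegrable _ _), hreflect, two_mul]

theorem ellipticK_zero : ellipticK 0 = Real.pi / 2 := by simp [ellipticK]

theorem ellipticD_zero : ellipticD 0 = Real.pi / 4 := by
  have h_integrand : ∀ φ : ℝ,
      Real.sin φ ^ 2 / √(1 - 0 ^ 2 * Real.sin φ ^ 2) = Real.sin φ ^ 2 := fun φ => by simp
  simp only [ellipticD, h_integrand, integral_sin_sq, Real.sin_zero, Real.cos_pi_div_two]
  ring

/-- The reciprocal `1 / Δ(φ)` of the elliptic delta amplitude, the integrand of `ellipticK`. -/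
def invDelta (ε φ : ℝ) : ℝ := (√(1 - ε ^ 2 * Real.sin φ ^ 2))⁻¹

theorem ellipticK_eq (ε : ℝ) : ellipticK ε = ∫ φ in (0 : ℝ)..(Real.pi / 2), invDelta ε φ := by
  simp only [ellipticK, invDelta, one_div]

theorem ellipticD_eq (ε : ℝ) :
    ellipticD ε = ∫ φ in (0 : ℝ)..(Real.pi / 2), Real.sin φ ^ 2 * invDelta ε φ := by
  simp only [ellipticD, invDelta, div_eq_mul_inv]

theorem invDelta_even (ε : ℝ) : (invDelta ε).Even := fun φ => by
  simp only [invDelta, Real.sin_neg, neg_sq]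

variable {ε : ℝ}

theorem one_sub_sq_mul_sin_sq_pos (hε : ε ^ 2 < 1) (φ : ℝ) : 0 < 1 - ε ^ 2 * Real.sin φ ^ 2 := by
  nlinarith [mul_le_mul_of_nonneg_left (Real.sin_sq_le_one φ) (sq_nonneg ε)]

theorem invDelta_pos (hε : ε ^ 2 < 1) (φ : ℝ) : 0 < invDelta ε φ :=
  inv_pos.2 (Real.sqrt_pos.2 (one_sub_sq_mul_sin_sq_pos hε φ))

theorem continuous_invDelta (hε : ε ^ 2 < 1) : Continuous (invDelta ε) :=
  Continuous.inv₀ (by fun_prop) fun φ =>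
    (Real.sqrt_pos.2 (one_sub_sq_mul_sin_sq_pos hε φ)).ne'

theorem ellipticK_pos (hε : ε ^ 2 < 1) : 0 < ellipticK ε := by
  rw [ellipticK_eq]
  exact intervalIntegral.intervalIntegral_pos_of_pos_on
    ((continuous_invDelta hε).intervalIntegrable _ _) (fun φ _ => invDelta_pos hε φ)
    Real.pi_div_two_pos

theorem ellipticD_pos (hε : ε ^ 2 < 1) : 0 < ellipticD ε := by
  rw [ellipticD_eq]
  refine intervalIntegral.intervalIntegral_pos_of_pos_on
    (((Real.continuous_sin.pow 2).mul (continuous_invDelta hε)).intervalIntegrable _ _)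
    (fun φ hφ => ?_) Real.pi_div_two_pos
  have := Real.sin_pos_of_pos_of_lt_pi hφ.1 (by linarith [hφ.2, Real.pi_pos])
  exact mul_pos (by positivity) (invDelta_pos hε φ)

theorem hasDerivAt_sin_mul_cos_mul_invDelta (hε : ε ^ 2 < 1) (φ : ℝ) :
    HasDerivAt (fun φ => Real.sin φ * Real.cos φ * invDelta ε φ)
      (Real.cos φ ^ 2 * invDelta ε φ ^ 3 - Real.sin φ ^ 2 * invDelta ε φ) φ := by
  have hpos := one_sub_sq_mul_sin_sq_pos hε φ
  have hsqrt := Real.sqrt_pos.2 hpos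
  have hrad : HasDerivAt (fun φ => 1 - ε ^ 2 * Real.sin φ ^ 2)
      (-(ε ^ 2 * (2 * Real.sin φ * Real.cos φ))) φ := by
    simpa using (((Real.hasDerivAt_sin φ).pow 2).const_mul (ε ^ 2)).const_sub 1
  have hprod := ((Real.hasDerivAt_sin φ).mul (Real.hasDerivAt_cos φ)).mul
    ((hrad.sqrt hpos.ne').inv hsqrt.ne')
  refine hprod.congr_deriv ?_
  have hsq : √(1 - ε ^ 2 * Real.sin φ ^ 2) ^ 2 = 1 - ε ^ 2 * Real.sin φ ^ 2 :=
    Real.sq_sqrt hpos.le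
  rw [Pi.mul_apply, Pi.inv_apply, invDelta]
  generalize √(1 - ε ^ 2 * Real.sin φ ^ 2) = r at hsqrt hsq ⊢
  field_simp
  rw [hsq, Real.cos_sq']
  ring

theorem integral_cos_sq_mul_invDelta_cube (hε : ε ^ 2 < 1) :
    ∫ φ in (0 : ℝ)..(Real.pi / 2), Real.cos φ ^ 2 * invDelta ε φ ^ 3 = ellipticD ε := by
  have hcos : IntervalIntegrable (fun φ => Real.cos φ ^ 2 * invDelta ε φ ^ 3) volume 0
      (Real.pi / 2) :=
    ((Real.continuous_cos.pow 2).mul ((continuous_invDelta hε).pow 3)).intervalIntegrable _ _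
  have hsin : IntervalIntegrable (fun φ => Real.sin φ ^ 2 * invDelta ε φ) volume 0
      (Real.pi / 2) :=
    ((Real.continuous_sin.pow 2).mul (continuous_invDelta hε)).intervalIntegrable _ _
  rw [ellipticD_eq, ← sub_eq_zero, ← intervalIntegral.integral_sub hcos hsin,
    intervalIntegral.integral_eq_sub_of_hasDerivAt
      (fun φ _ => hasDerivAt_sin_mul_cos_mul_invDelta hε φ) (hcos.sub hsin)]
  simp

variable {a b : ℝ}

theorem eccentricity_sq (hb : 0 < b) (hab : b ≤ a) : eccentricity a b ^ 2 = 1 - b ^ 2 / a ^ 2 := by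
  have ha : 0 < a := hb.trans_le hab
  have hle : b ^ 2 / a ^ 2 ≤ 1 := (div_le_one (by positivity)).2 (by gcongr)
  rw [eccentricity, Real.sq_sqrt (by linarith)]

theorem eccentricity_sq_lt_one (hb : 0 < b) (hab : b ≤ a) : eccentricity a b ^ 2 < 1 := by
  have ha : 0 < a := hb.trans_le hab
  rw [eccentricity_sq hb hab]
  exact sub_lt_self 1 (by positivity)

theorem inv_sqrt_tan_sq_div_add (hb : 0 < b) (hab : b ≤ a) {φ : ℝ} (hφ : 0 < Real.cos φ) :
    (√(Real.tan φ ^ 2 / a ^ 2 + 1 / b ^ 2))⁻¹ =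
      b * Real.cos φ * invDelta (eccentricity a b) φ := by
  have ha : 0 < a := hb.trans_le hab
  have hpos := one_sub_sq_mul_sin_sq_pos (eccentricity_sq_lt_one hb hab) φ
  have hrad : Real.tan φ ^ 2 / a ^ 2 + 1 / b ^ 2 =
      (1 - eccentricity a b ^ 2 * Real.sin φ ^ 2) / (b * Real.cos φ) ^ 2 := by
    rw [eccentricity_sq hb hab, Real.tan_eq_sin_div_cos]
    field_simp
    rw [Real.sin_sq]
    ring
  rw [hrad, Real.sqrt_div hpos.le, Real.sqrt_sq (by positivity), inv_div, invDelta, div_eq_mul_inv]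

theorem integral_slope_eq_ellipticK (hb : 0 < b) (hab : b ≤ a) :
    ∫ u : ℝ, (√(1 + u ^ 2))⁻¹ * (√(u ^ 2 / a ^ 2 + 1 / b ^ 2))⁻¹ =
      2 * b * ellipticK (eccentricity a b) := by
  have hε := eccentricity_sq_lt_one hb hab
  have hsubst : ∀ φ ∈ Ioo (-(Real.pi / 2)) (Real.pi / 2), (Real.cos φ ^ 2)⁻¹ •
      ((√(1 + Real.tan φ ^ 2))⁻¹ * (√(Real.tan φ ^ 2 / a ^ 2 + 1 / b ^ 2))⁻¹) =
      b * invDelta (eccentricity a b) φ := by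
    intro φ hφ
    have hcos := Real.cos_pos_of_mem_Ioo hφ
    rw [Real.inv_sqrt_one_add_tan_sq hcos, inv_sqrt_tan_sq_div_add hb hab hcos, smul_eq_mul]
    field_simp
  rw [integral_eq_setIntegral_tan, setIntegral_congr_fun measurableSet_Ioo hsubst,
    integral_const_mul, setIntegral_Ioo_neg_self_of_even (continuous_invDelta hε)
      (invDelta_even _) Real.pi_div_two_pos.le, ellipticK_eq]
  ring

theorem integral_slope_cube_eq_ellipticD (hb : 0 < b) (hab : b ≤ a) :
    ∫ u : ℝ, (√(1 + u ^ 2))⁻¹ * (√(u ^ 2 / a ^ 2 + 1 / b ^ 2))⁻¹ ^ 3 =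
      2 * b ^ 3 * ellipticD (eccentricity a b) := by
  have hε := eccentricity_sq_lt_one hb hab
  have hsubst : ∀ φ ∈ Ioo (-(Real.pi / 2)) (Real.pi / 2), (Real.cos φ ^ 2)⁻¹ •
      ((√(1 + Real.tan φ ^ 2))⁻¹ * (√(Real.tan φ ^ 2 / a ^ 2 + 1 / b ^ 2))⁻¹ ^ 3) =
      b ^ 3 * (Real.cos φ ^ 2 * invDelta (eccentricity a b) φ ^ 3) := by
    intro φ hφ
    have hcos := Real.cos_pos_of_mem_Ioo hφ
    rw [Real.inv_sqrt_one_add_tan_sq hcos, inv_sqrt_tan_sq_div_add hb hab hcos, smul_eq_mul]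
    field_simp
  have hcont : Continuous fun φ => Real.cos φ ^ 2 * invDelta (eccentricity a b) φ ^ 3 :=
    (Real.continuous_cos.pow 2).mul ((continuous_invDelta hε).pow 3)
  have heven : (fun φ => Real.cos φ ^ 2 * invDelta (eccentricity a b) φ ^ 3).Even := fun φ => by
    simp only [Real.cos_neg, invDelta_even _ φ]
  rw [integral_eq_setIntegral_tan, setIntegral_congr_fun measurableSet_Ioo hsubst,
    integral_const_mul, setIntegral_Ioo_neg_self_of_even
      hcont heven Real.pi_div_two_pos.le, integral_cos_sq_mul_invDelta_cube hε]
  ring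

theorem integrable_slope (ha : 0 < a) (hb : 0 < b) :
    Integrable fun u : ℝ => (√(1 + u ^ 2))⁻¹ * (√(u ^ 2 / a ^ 2 + 1 / b ^ 2))⁻¹ := by
  refine (integrable_inv_one_add_sq.const_mul (max a b)).mono' (by fun_prop)
    (.of_forall fun u => ?_)
  have hc : 0 < max a b := ha.trans_le (le_max_left a b)
  have hslope : (1 + u ^ 2) / max a b ^ 2 ≤ u ^ 2 / a ^ 2 + 1 / b ^ 2 := by
    rw [add_div, add_comm]
    gcongr
    exacts [le_max_left a b, le_max_right a b]
  calc ‖(√(1 + u ^ 2))⁻¹ * (√(u ^ 2 / a ^ 2 + 1 / b ^ 2))⁻¹‖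
      = (√(1 + u ^ 2))⁻¹ * (√(u ^ 2 / a ^ 2 + 1 / b ^ 2))⁻¹ :=
        Real.norm_of_nonneg (by positivity)
    _ ≤ (√(1 + u ^ 2))⁻¹ * (√((1 + u ^ 2) / max a b ^ 2))⁻¹ := by gcongr
    _ = max a b * (1 + u ^ 2)⁻¹ := by
        rw [Real.sqrt_div (by positivity), Real.sqrt_sq hc.le, inv_div, mul_div_assoc', mul_comm,
          mul_div_assoc, div_eq_mul_inv, ← mul_inv, Real.mul_self_sqrt (by positivity)]

end EllipticIntegrals

section WeightedChangeOfVariables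

variable {X Y F : Type*} [MeasurableSpace X] [MeasurableSpace Y] [NormedAddCommGroup F]
  [NormedSpace ℝ F] {μ : Measure X} {ν : Measure Y} {w : X → ℝ} {φ : X → Y} {f : Y → F}

theorem integrable_iff_of_measurePreserving_withDensity (hw : Measurable w) (hw0 : 0 ≤ w)
    (hφ : MeasurePreserving φ (μ.withDensity fun p => ENNReal.ofReal (w p)) ν)
    (hf : AEStronglyMeasurable f ν) :
    Integrable f ν ↔ Integrable (fun p => w p • f (φ p)) μ := by
  rw [← hφ.integrable_comp hf, integrable_withDensity_iff_integrable_smul' (by fun_prop) (by simp)]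
  simp only [ENNReal.toReal_ofReal (hw0 _), Function.comp_apply]

theorem integral_eq_of_measurePreserving_withDensity (hw : Measurable w) (hw0 : 0 ≤ w)
    (hφ : MeasurePreserving φ (μ.withDensity fun p => ENNReal.ofReal (w p)) ν)
    (hf : AEStronglyMeasurable f ν) : ∫ y, f y ∂ν = ∫ p, w p • f (φ p) ∂μ := by
  rw [← hφ.map_eq] at hf ⊢
  rw [integral_map hφ.aemeasurable hf,
    integral_withDensity_eq_integral_toReal_smul (by fun_prop) (by simp)]
  simp only [ENNReal.toReal_ofReal (hw0 _)]

end WeightedChangeOfVariables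

section ConeCoordinates

variable {E X F : Type*} [NormedAddCommGroup E] [NormedSpace ℝ E] [FiniteDimensional ℝ E]
  [MeasurableSpace E] [BorelSpace E] {μ : Measure E} [μ.IsAddHaarMeasure]

theorem lintegral_prod_eq_lintegral_cone {f : E × ℝ → ENNReal} (hf : Measurable f) :
    ∫⁻ p, f p ∂(μ.prod volume) =
      ∫⁻ p, ENNReal.ofReal (|p.2| ^ Module.finrank ℝ E) * f (p.2 • p.1, p.2)
        ∂(μ.prod volume) := by
  rw [lintegral_prod_symm _ hf.aemeasurable, lintegral_prod_symm _ (by fun_prop)]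
  refine lintegral_congr_ae ?_
  filter_upwards [Measure.ae_ne volume (0 : ℝ)] with h hh
  have hfh : Measurable fun u => f (u, h) := by fun_prop
  rw [lintegral_const_mul _ (by fun_prop),
    ← lintegral_map (f := fun u => f (u, h)) (μ := μ) hfh (measurable_const_smul h),
    Measure.map_addHaar_smul μ hh, lintegral_smul_measure, smul_eq_mul, ← mul_assoc,
    ← ENNReal.ofReal_mul (by positivity), abs_inv, abs_pow, mul_inv_cancel₀ (by positivity),
    ENNReal.ofReal_one, one_mul]

theorem measurePreserving_smul_snd :
    MeasurePreserving (fun p : E × ℝ => (p.2 • p.1, p.2))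
      ((μ.prod volume).withDensity fun p => ENNReal.ofReal (|p.2| ^ Module.finrank ℝ E))
      (μ.prod volume) := by
  refine ⟨by fun_prop, Measure.ext_of_lintegral _ fun f hf => ?_⟩
  rw [lintegral_map hf (by fun_prop), lintegral_withDensity_eq_lintegral_mul _ (by fun_prop)
    (by fun_prop), lintegral_prod_eq_lintegral_cone hf]
  rfl

variable [NormedAddCommGroup X] [NormedSpace ℝ X] [MeasurableSpace X] [BorelSpace X]
  {ν : Measure X} [ν.IsAddLeftInvariant] [NormedAddCommGroup F] [NormedSpace ℝ F]
  {e : (E × ℝ) ≃L[ℝ] X} {f : X → F}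

theorem measurePreserving_cone (he : MeasurePreserving e (μ.prod volume) ν) (x : X) :
    MeasurePreserving (fun p : E × ℝ => x + p.2 • e (p.1, 1))
      ((μ.prod volume).withDensity fun p => ENNReal.ofReal (|p.2| ^ Module.finrank ℝ E)) ν := by
  have hcomp := (measurePreserving_add_left ν x).comp (he.comp measurePreserving_smul_snd)
  have hmap : (fun p : E × ℝ => x + p.2 • e (p.1, 1)) =
      (x + ·) ∘ e ∘ fun p : E × ℝ => (p.2 • p.1, p.2) := by
    ext p
    simp only [Function.comp_apply, ← map_smul, Prod.smul_mk, smul_eq_mul, mul_one]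
  exact hmap ▸ hcomp

theorem integrable_iff_cone (he : MeasurePreserving e (μ.prod volume) ν) (x : X)
    (hf : AEStronglyMeasurable f ν) :
    Integrable f ν ↔ Integrable
      (fun p : E × ℝ => |p.2| ^ Module.finrank ℝ E • f (x + p.2 • e (p.1, 1))) (μ.prod volume) :=
  integrable_iff_of_measurePreserving_withDensity (by fun_prop) (fun _ => by positivity)
    (measurePreserving_cone he x) hf

theorem integral_eq_cone (he : MeasurePreserving e (μ.prod volume) ν) (x : X)
    (hf : AEStronglyMeasurable f ν) :
    ∫ y, f y ∂ν =
      ∫ p : E × ℝ, |p.2| ^ Module.finrank ℝ E • f (x + p.2 • e (p.1, 1)) ∂(μ.prod volume) :=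
  integral_eq_of_measurePreserving_withDensity (by fun_prop) (fun _ => by positivity)
    (measurePreserving_cone he x) hf

end ConeCoordinates

section Coordinates

/-- Cartesian coordinates on the Euclidean plane, as an isomorphism from the product of lines. -/
def planeEquiv : (ℝ × ℝ) ≃L[ℝ] EuclideanSpace ℝ (Fin 2) :=
  ((EuclideanSpace.equiv (Fin 2) ℝ).trans (ContinuousLinearEquiv.finTwoArrow ℝ ℝ)).symm

/-- Euclidean 3-space as the product of the plane `x₃ = 0` with the vertical axis, the pair
`(y, s)` corresponding to `lift3 y s`. -/
def lift3Equiv : (EuclideanSpace ℝ (Fin 2) × ℝ) ≃L[ℝ] EuclideanSpace ℝ (Fin 3) :=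
  LinearEquiv.toContinuousLinearEquiv
    { toFun p := lift3 p.1 p.2
      invFun x := (!₂[x 0, x 1], x 2)
      map_add' p q := by ext i; fin_cases i <;> rfl
      map_smul' c p := by ext i; fin_cases i <;> rfl
      left_inv p := by
        ext i
        · fin_cases i <;> rfl
        · rfl
      right_inv x := by ext i; fin_cases i <;> rfl }

theorem planeEquiv_apply (p : ℝ × ℝ) : planeEquiv p = !₂[p.1, p.2] := rfl

theorem lift3Equiv_apply (p : EuclideanSpace ℝ (Fin 2) × ℝ) : lift3Equiv p = lift3 p.1 p.2 := rfl

theorem measurePreserving_planeEquiv :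
    MeasurePreserving planeEquiv (volume.prod volume) volume :=
  ((volume_preserving_finTwoArrow ℝ).comp (PiLp.volume_preserving_ofLp (Fin 2))).symm
    planeEquiv.toHomeomorph.toMeasurableEquiv.symm

theorem measurePreserving_lift3Equiv :
    MeasurePreserving lift3Equiv (volume.prod volume) volume := by
  have hsplit := (volume_preserving_piFinSuccAbove (fun _ : Fin 3 => ℝ) (Fin.last 2)).comp
    (PiLp.volume_preserving_ofLp (Fin 3))
  have hplane := (PiLp.volume_preserving_toLp (Fin 2)).prod
    (MeasurePreserving.id (volume : Measure ℝ))
  have hcomp := (hplane.comp Measure.measurePreserving_swap).comp hsplit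
  refine MeasurePreserving.symm lift3Equiv.toHomeomorph.toMeasurableEquiv.symm ?_
  convert hcomp using 1
  ext x i
  · fin_cases i <;> rfl
  · rfl

theorem continuous_lift3 : Continuous fun p : EuclideanSpace ℝ (Fin 2) × ℝ => lift3 p.1 p.2 :=
  lift3Equiv.continuous

end Coordinates

section PlanePotential

theorem norm_slope (u : ℝ) : ‖!₂[u, 1]‖ = √(1 + u ^ 2) := by
  simp only [EuclideanSpace.norm_eq, Fin.sum_univ_two, Real.norm_eq_abs, sq_abs,
    Matrix.cons_val_zero, Matrix.cons_val_one, one_pow, add_comm]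

theorem continuous_chord (x : EuclideanSpace ℝ (Fin 2)) :
    Continuous fun p : ℝ × ℝ => x + p.2 • !₂[p.1, 1] :=
  continuous_const.add (continuous_snd.smul
    (planeEquiv.continuous.comp (continuous_fst.prodMk continuous_const)))

theorem abs_mul_div_norm_smul {E : Type*} [NormedAddCommGroup E] [NormedSpace ℝ E] {h : ℝ}
    (hh : h ≠ 0) (c : ℝ) (x v : E) : |h| * (c / ‖x - (x + h • v)‖) = ‖v‖⁻¹ * c := by
  rw [sub_add_cancel_left, norm_neg, norm_smul, Real.norm_eq_abs, mul_div_assoc',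
    mul_div_mul_left _ _ (abs_pos.2 hh).ne', div_eq_inv_mul]

section Chords

variable {g : EuclideanSpace ℝ (Fin 2) → ℝ}

-- The Jacobian `|h|` of the coordinates `y = x + h (u, 1)` cancels the singularity of the kernel.
theorem cone_div_norm_ae_eq (x : EuclideanSpace ℝ (Fin 2)) :
    (fun p : ℝ × ℝ => |p.2| ^ Module.finrank ℝ ℝ •
      (g (x + p.2 • planeEquiv (p.1, 1)) / ‖x - (x + p.2 • planeEquiv (p.1, 1))‖))
      =ᵐ[volume.prod volume] fun p : ℝ × ℝ => (√(1 + p.1 ^ 2))⁻¹ * g (x + p.2 • !₂[p.1, 1]) := by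
  filter_upwards [Measure.quasiMeasurePreserving_snd.ae (Measure.ae_ne volume 0)] with p hp
  rw [Module.finrank_self, pow_one, smul_eq_mul, planeEquiv_apply, abs_mul_div_norm_smul hp,
    norm_slope]

theorem integrable_div_norm_iff_chords (hg : Measurable g) (x : EuclideanSpace ℝ (Fin 2)) :
    Integrable (fun y => g y / ‖x - y‖) ↔
      Integrable (fun p : ℝ × ℝ => (√(1 + p.1 ^ 2))⁻¹ * g (x + p.2 • !₂[p.1, 1]))
        (volume.prod volume) :=
  (integrable_iff_cone measurePreserving_planeEquiv x
    (Measurable.aestronglyMeasurable (by fun_prop))).trans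
    (integrable_congr (cone_div_norm_ae_eq x))

theorem integral_div_norm_eq_chords (hg : Measurable g) {x : EuclideanSpace ℝ (Fin 2)}
    (hi : Integrable fun y => g y / ‖x - y‖) :
    ∫ y, g y / ‖x - y‖ = ∫ u : ℝ, (√(1 + u ^ 2))⁻¹ * ∫ h : ℝ, g (x + h • !₂[u, 1]) := by
  rw [integral_eq_cone measurePreserving_planeEquiv x
    (Measurable.aestronglyMeasurable (by fun_prop))]
  refine (integral_congr_ae (cone_div_norm_ae_eq x)).trans ?_
  rw [integral_prod _ ((integrable_div_norm_iff_chords hg x).1 hi)]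
  simp only [integral_const_mul]

end Chords

variable {a b : ℝ}

/-- The density profile `(1 - y₁² / a² - y₂² / b²)^(-1/2)` on the elliptic disk; by the junk values
of the square root and of the inverse it vanishes off the disk. -/
def profile (a b : ℝ) (y : EuclideanSpace ℝ (Fin 2)) : ℝ :=
  (√(1 - y 0 ^ 2 / a ^ 2 - y 1 ^ 2 / b ^ 2))⁻¹

/-- The product of `profile a b` with the affine function `α + β y₁`; both `rhoW` and `rhoT` are of
this form. -/
def affineDensity (a b α β : ℝ) (y : EuclideanSpace ℝ (Fin 2)) : ℝ :=
  (α + β * y 0) * profile a b y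

theorem rhoW_eq_affineDensity :
    rhoW a b = affineDensity a b (b * ellipticK (eccentricity a b))⁻¹ 0 := by
  ext y
  rw [rhoW, affineDensity, profile, zero_mul, add_zero, one_div, mul_inv]

theorem rhoT_eq_affineDensity :
    rhoT a b = affineDensity a b 0 (b * ellipticD (eccentricity a b))⁻¹ := by
  ext y
  rw [rhoT, affineDensity, profile, zero_add, div_eq_mul_inv, mul_inv, mul_left_comm, mul_assoc]

@[fun_prop]
theorem measurable_profile : Measurable (profile a b) := by
  unfold profile
  fun_prop

theorem profile_nonneg (y : EuclideanSpace ℝ (Fin 2)) : 0 ≤ profile a b y :=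
  inv_nonneg.2 (Real.sqrt_nonneg _)

theorem one_sub_pos_of_mem_ellipticDisk {y : EuclideanSpace ℝ (Fin 2)} (hy : y ∈ ellipticDisk a b) :
    0 < 1 - y 0 ^ 2 / a ^ 2 - y 1 ^ 2 / b ^ 2 := by
  rw [sub_sub, sub_pos]
  exact hy

theorem profile_eq_zero {y : EuclideanSpace ℝ (Fin 2)} (hy : y ∉ ellipticDisk a b) :
    profile a b y = 0 := by
  have hneg : 1 - y 0 ^ 2 / a ^ 2 - y 1 ^ 2 / b ^ 2 ≤ 0 := by
    rw [sub_sub, sub_nonpos]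
    exact not_lt.1 hy
  rw [profile, Real.sqrt_eq_zero_of_nonpos hneg, inv_zero]

theorem continuousOn_profile : ContinuousOn (profile a b) (ellipticDisk a b) :=
  ContinuousOn.inv₀ (by fun_prop) fun _ hy =>
    (Real.sqrt_pos.2 (one_sub_pos_of_mem_ellipticDisk hy)).ne'

theorem abs_coord_lt (ha : 0 < a) {y : EuclideanSpace ℝ (Fin 2)} (hy : y ∈ ellipticDisk a b) :
    |y 0| < a := by
  have hlt : y 0 ^ 2 / a ^ 2 < 1 := lt_of_le_of_lt (le_add_of_nonneg_right (by positivity)) hy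
  exact abs_lt_of_sq_lt_sq ((div_lt_one (by positivity)).1 hlt) ha.le

/-- The parameter of the midpoint of the chord through `x` in the direction `(u, 1)`. -/
def chordMid (a b : ℝ) (x : EuclideanSpace ℝ (Fin 2)) (u : ℝ) : ℝ :=
  -(x 0 * u / a ^ 2 + x 1 / b ^ 2) / (u ^ 2 / a ^ 2 + 1 / b ^ 2)

theorem profile_chord (hb : 0 < b) (x : EuclideanSpace ℝ (Fin 2)) (u h : ℝ) :
    profile a b (x + h • !₂[u, 1]) =
      (√((1 - x 0 ^ 2 / a ^ 2 - x 1 ^ 2 / b ^ 2 +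
          (u ^ 2 / a ^ 2 + 1 / b ^ 2) * chordMid a b x u ^ 2) -
        (u ^ 2 / a ^ 2 + 1 / b ^ 2) * (h - chordMid a b x u) ^ 2))⁻¹ := by
  have hmid : (u ^ 2 / a ^ 2 + 1 / b ^ 2) * chordMid a b x u = -(x 0 * u / a ^ 2 + x 1 / b ^ 2) :=
    mul_div_cancel₀ _ (by positivity)
  simp only [profile, PiLp.add_apply, PiLp.smul_apply, smul_eq_mul, Matrix.cons_val_zero,
    Matrix.cons_val_one, mul_one]
  congr 2
  linear_combination (-2 * h) * hmid

theorem coord_add_chordMid_mul (hb : 0 < b) (x : EuclideanSpace ℝ (Fin 2)) (u : ℝ) :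
    x 0 + chordMid a b x u * u = (x 0 - x 1 * u) / b ^ 2 / (u ^ 2 / a ^ 2 + 1 / b ^ 2) := by
  have hq : u ^ 2 / a ^ 2 + 1 / b ^ 2 ≠ 0 := by positivity
  rw [chordMid, eq_div_iff hq, add_mul, div_mul_eq_mul_div, div_mul_cancel₀ _ hq]
  ring

variable {x : EuclideanSpace ℝ (Fin 2)}

theorem chord_discriminant_pos (hb : 0 < b) (hx : x ∈ ellipticDisk a b) (u : ℝ) :
    0 < 1 - x 0 ^ 2 / a ^ 2 - x 1 ^ 2 / b ^ 2 +
      (u ^ 2 / a ^ 2 + 1 / b ^ 2) * chordMid a b x u ^ 2 :=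
  add_pos_of_pos_of_nonneg (one_sub_pos_of_mem_ellipticDisk hx) (by positivity)

theorem integrable_profile_chord (hb : 0 < b) (hx : x ∈ ellipticDisk a b) (u : ℝ) :
    Integrable fun h : ℝ => profile a b (x + h • !₂[u, 1]) := by
  simp_rw [profile_chord hb]
  exact integrable_inv_sqrt_sub_mul_sq (chord_discriminant_pos hb hx u) (by positivity) _

theorem integral_profile_chord (hb : 0 < b) (hx : x ∈ ellipticDisk a b) (u : ℝ) :
    ∫ h : ℝ, profile a b (x + h • !₂[u, 1]) = Real.pi * (√(u ^ 2 / a ^ 2 + 1 / b ^ 2))⁻¹ := by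
  simp_rw [profile_chord hb]
  exact integral_inv_sqrt_sub_mul_sq (chord_discriminant_pos hb hx u) (by positivity) _

theorem integral_affineDensity_chord (hb : 0 < b) (hx : x ∈ ellipticDisk a b) (α β u : ℝ) :
    ∫ h : ℝ, affineDensity a b α β (x + h • !₂[u, 1]) =
      α * Real.pi * (√(u ^ 2 / a ^ 2 + 1 / b ^ 2))⁻¹ +
        β * Real.pi / b ^ 2 * ((x 0 - x 1 * u) * (√(u ^ 2 / a ^ 2 + 1 / b ^ 2))⁻¹ ^ 3) := by
  have haffine : ∀ h : ℝ, affineDensity a b α β (x + h • !₂[u, 1]) =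
      ((α + β * x 0) + β * u * h) * profile a b (x + h • !₂[u, 1]) := fun h => by
    simp only [affineDensity, PiLp.add_apply, PiLp.smul_apply, smul_eq_mul, Matrix.cons_val_zero]
    ring
  have hq : 0 < u ^ 2 / a ^ 2 + 1 / b ^ 2 := by positivity
  have hsq : (√(u ^ 2 / a ^ 2 + 1 / b ^ 2))⁻¹ ^ 2 = (u ^ 2 / a ^ 2 + 1 / b ^ 2)⁻¹ := by
    rw [inv_pow, Real.sq_sqrt hq.le]
  simp_rw [haffine, profile_chord hb]
  rw [integral_affine_mul_inv_sqrt_sub_mul_sq (chord_discriminant_pos hb hx u) hq,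
    pow_succ _ 2, hsq]
  linear_combination β * Real.pi / √(u ^ 2 / a ^ 2 + 1 / b ^ 2) *
    coord_add_chordMid_mul (a := a) hb x u

theorem integrable_profile_div_norm (ha : 0 < a) (hb : 0 < b) (hx : x ∈ ellipticDisk a b) :
    Integrable fun y => profile a b y / ‖x - y‖ := by
  have hmeas : Measurable fun p : ℝ × ℝ =>
      (√(1 + p.1 ^ 2))⁻¹ * profile a b (x + p.2 • !₂[p.1, 1]) :=
    .mul (by fun_prop) (measurable_profile.comp (continuous_chord x).measurable)
  rw [integrable_div_norm_iff_chords measurable_profile,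
    integrable_prod_iff hmeas.aestronglyMeasurable]
  refine ⟨.of_forall fun u => (integrable_profile_chord hb hx u).const_mul (√(1 + u ^ 2))⁻¹,
    ((integrable_slope ha hb).const_mul Real.pi).congr (.of_forall fun u => ?_)⟩
  simp only [norm_mul, Real.norm_of_nonneg (profile_nonneg _), norm_inv,
    Real.norm_of_nonneg (Real.sqrt_nonneg _), integral_const_mul, integral_profile_chord hb hx]
  ring

theorem integral_profile_div_norm (hb : 0 < b) (hab : b ≤ a) (hx : x ∈ ellipticDisk a b) :
    ∫ y, profile a b y / ‖x - y‖ = 2 * Real.pi * b * ellipticK (eccentricity a b) := by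
  rw [integral_div_norm_eq_chords measurable_profile
    (integrable_profile_div_norm (hb.trans_le hab) hb hx)]
  simp only [integral_profile_chord hb hx, mul_left_comm _ Real.pi]
  rw [integral_const_mul, integral_slope_eq_ellipticK hb hab]
  ring

variable {α β : ℝ}

@[fun_prop]
theorem measurable_affineDensity : Measurable (affineDensity a b α β) := by
  unfold affineDensity
  fun_prop

theorem affineDensity_eq_zero (hx : x ∉ ellipticDisk a b) : affineDensity a b α β x = 0 := by
  rw [affineDensity, profile_eq_zero hx, mul_zero]

theorem continuousOn_affineDensity : ContinuousOn (affineDensity a b α β) (ellipticDisk a b) :=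
  ContinuousOn.mul (by fun_prop) continuousOn_profile

theorem norm_affine_coord_le (ha : 0 < a) (hx : x ∈ ellipticDisk a b) :
    ‖α + β * x 0‖ ≤ |α| + |β| * a :=
  calc ‖α + β * x 0‖ ≤ |α| + |β| * |x 0| := (norm_add_le _ _).trans_eq (by simp)
    _ ≤ |α| + |β| * a := by gcongr; exact (abs_coord_lt ha hx).le

theorem norm_affineDensity_le (ha : 0 < a) (y : EuclideanSpace ℝ (Fin 2)) :
    ‖affineDensity a b α β y‖ ≤ (|α| + |β| * a) * profile a b y := by
  by_cases hy : y ∈ ellipticDisk a b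
  · rw [affineDensity, norm_mul, Real.norm_of_nonneg (profile_nonneg y)]
    exact mul_le_mul_of_nonneg_right (norm_affine_coord_le ha hy) (profile_nonneg y)
  · rw [affineDensity_eq_zero hy, profile_eq_zero hy, norm_zero, mul_zero]

theorem norm_affineDensity_div_norm_le (ha : 0 < a) (y : EuclideanSpace ℝ (Fin 2)) :
    ‖affineDensity a b α β y / ‖x - y‖‖ ≤ (|α| + |β| * a) * (profile a b y / ‖x - y‖) := by
  rw [norm_div, norm_norm, ← mul_div_assoc]
  exact div_le_div_of_nonneg_right (norm_affineDensity_le ha y) (norm_nonneg _)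

theorem integrable_affineDensity_div_norm (ha : 0 < a) (hb : 0 < b) (hx : x ∈ ellipticDisk a b) :
    Integrable fun y => affineDensity a b α β y / ‖x - y‖ :=
  ((integrable_profile_div_norm ha hb hx).const_mul (|α| + |β| * a)).mono'
    (Measurable.aestronglyMeasurable (by fun_prop)) (.of_forall (norm_affineDensity_div_norm_le ha))

theorem setIntegral_norm_affineDensity_div_norm_le (hb : 0 < b) (hab : b ≤ a)
    (hx : x ∈ ellipticDisk a b) : ∫ y in ellipticDisk a b, ‖affineDensity a b α β y / ‖x - y‖‖ ≤
      (|α| + |β| * a) * (2 * Real.pi * b * ellipticK (eccentricity a b)) := by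
  have ha := hb.trans_le hab
  rw [← integral_profile_div_norm hb hab hx, ← integral_const_mul]
  exact (setIntegral_le_integral (integrable_affineDensity_div_norm ha hb hx).norm
    (.of_forall fun _ => norm_nonneg _)).trans
    (integral_mono (integrable_affineDensity_div_norm ha hb hx).norm
      ((integrable_profile_div_norm ha hb hx).const_mul _) (norm_affineDensity_div_norm_le ha))

theorem abs_affine_mul_inv_le (ha : 0 < a) (hb : 0 < b) (A B u : ℝ) :
    |(A + B * u) * (u ^ 2 / a ^ 2 + 1 / b ^ 2)⁻¹| ≤ |A| * b ^ 2 + |B| * (a * b) := by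
  have hq : 0 < u ^ 2 / a ^ 2 + 1 / b ^ 2 := by positivity
  have hone : 1 ≤ b ^ 2 * (u ^ 2 / a ^ 2 + 1 / b ^ 2) := by
    rw [mul_add, mul_one_div_cancel (by positivity)]
    exact le_add_of_nonneg_left (by positivity)
  have hlin : |u| ≤ a * b * (u ^ 2 / a ^ 2 + 1 / b ^ 2) := by
    have hamgm := two_mul_le_add_sq (|u| / a) (1 / b)
    have hcancel : a * b * (|u| / a * (1 / b)) = |u| := by field_simp
    rw [div_pow, sq_abs, one_div_pow] at hamgm
    have := mul_le_mul_of_nonneg_left hamgm (mul_pos ha hb).le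
    linarith [abs_nonneg u]
  rw [abs_mul, abs_inv, abs_of_pos hq, ← div_eq_mul_inv, div_le_iff₀ hq]
  calc |A + B * u| ≤ |A| * 1 + |B| * |u| :=
        (abs_add_le _ _).trans_eq (by rw [mul_one, abs_mul])
    _ ≤ |A| * (b ^ 2 * (u ^ 2 / a ^ 2 + 1 / b ^ 2)) +
          |B| * (a * b * (u ^ 2 / a ^ 2 + 1 / b ^ 2)) := by gcongr
    _ = _ := by ring

theorem integrable_affine_mul_slope_cube (ha : 0 < a) (hb : 0 < b) (A B : ℝ) :
    Integrable fun u : ℝ =>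
      (A + B * u) * ((√(1 + u ^ 2))⁻¹ * (√(u ^ 2 / a ^ 2 + 1 / b ^ 2))⁻¹ ^ 3) := by
  refine ((integrable_slope ha hb).const_mul (|A| * b ^ 2 + |B| * (a * b))).mono'
    (Measurable.aestronglyMeasurable (by fun_prop)) (.of_forall fun u => ?_)
  have hq : 0 < u ^ 2 / a ^ 2 + 1 / b ^ 2 := by positivity
  have hsq : (√(u ^ 2 / a ^ 2 + 1 / b ^ 2))⁻¹ ^ 2 = (u ^ 2 / a ^ 2 + 1 / b ^ 2)⁻¹ := by
    rw [inv_pow, Real.sq_sqrt hq.le]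
  have hslope := abs_affine_mul_inv_le ha hb A B u
  have hnonneg : 0 ≤ (√(1 + u ^ 2))⁻¹ * (√(u ^ 2 / a ^ 2 + 1 / b ^ 2))⁻¹ := by positivity
  calc ‖(A + B * u) * ((√(1 + u ^ 2))⁻¹ * (√(u ^ 2 / a ^ 2 + 1 / b ^ 2))⁻¹ ^ 3)‖
      = |(A + B * u) * (u ^ 2 / a ^ 2 + 1 / b ^ 2)⁻¹| *
          ((√(1 + u ^ 2))⁻¹ * (√(u ^ 2 / a ^ 2 + 1 / b ^ 2))⁻¹) := by
        rw [← hsq, Real.norm_eq_abs, ← abs_of_nonneg hnonneg, ← abs_mul]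
        ring_nf
    _ ≤ _ := mul_le_mul_of_nonneg_right hslope hnonneg

-- The part of the chord integral that is odd in the slope `u` drops out.
theorem integral_affineDensity_div_norm (hb : 0 < b) (hab : b ≤ a) (hx : x ∈ ellipticDisk a b) :
    ∫ y, affineDensity a b α β y / ‖x - y‖ = 2 * Real.pi * b *
      (α * ellipticK (eccentricity a b) + β * ellipticD (eccentricity a b) * x 0) := by
  have ha := hb.trans_le hab
  have hcube := integrable_affine_mul_slope_cube ha hb (x 0) (-x 1)
  calc ∫ y, affineDensity a b α β y / ‖x - y‖
      = ∫ u : ℝ, (α * Real.pi * ((√(1 + u ^ 2))⁻¹ * (√(u ^ 2 / a ^ 2 + 1 / b ^ 2))⁻¹) +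
          β * Real.pi / b ^ 2 * ((x 0 + -x 1 * u) *
            ((√(1 + u ^ 2))⁻¹ * (√(u ^ 2 / a ^ 2 + 1 / b ^ 2))⁻¹ ^ 3))) := by
        rw [integral_div_norm_eq_chords measurable_affineDensity
          (integrable_affineDensity_div_norm ha hb hx)]
        simp only [integral_affineDensity_chord hb hx]
        congr with u
        ring
    _ = α * Real.pi * (2 * b * ellipticK (eccentricity a b)) +
          β * Real.pi / b ^ 2 * (x 0 * (2 * b ^ 3 * ellipticD (eccentricity a b))) := by
        rw [integral_add ((integrable_slope ha hb).const_mul _) (hcube.const_mul _),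
          integral_const_mul, integral_const_mul, integral_slope_eq_ellipticK hb hab,
          integral_affine_mul_of_even (fun u => by simp only [neg_sq]) hcube,
          integral_slope_cube_eq_ellipticD hb hab]
    _ = _ := by
        field_simp

end PlanePotential

section Superposition

variable {E F Y : Type*} [NormedAddCommGroup F] [MeasurableSpace Y] {μ : Measure Y} {ρ : Y → ℝ}
  {ι : Y → E} {K : Set E} {k : E → F} {x : E}

section Normed

variable [NormedAddCommGroup E]

theorem exists_ball_subset_compl_bound [ProperSpace E] (hK : IsCompact K)
    (hk : ContinuousOn k {0}ᶜ) (hx : x ∉ K) :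
    ∃ r > 0, ∃ M, ∀ x' ∈ Metric.ball x r, x' ∉ K ∧ ∀ z ∈ K, ‖k (x' - z)‖ ≤ M := by
  obtain ⟨r, hr, hsub⟩ := Metric.nhds_basis_closedBall.mem_iff.1
    (hK.isClosed.isOpen_compl.mem_nhds hx)
  have hcompact := ((isCompact_closedBall x r).prod hK).image continuous_sub
  obtain ⟨M, hM⟩ := hcompact.exists_bound_of_continuousOn (f := k) (hk.mono (by
    rintro _ ⟨⟨x', z⟩, ⟨hx', hz⟩, rfl⟩ hzero
    exact hsub hx' (by rwa [sub_eq_zero.1 hzero])))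
  exact ⟨r, hr, M, fun x' hx' => ⟨hsub (Metric.ball_subset_closedBall hx'), fun z hz =>
    hM _ ⟨(x', z), ⟨Metric.ball_subset_closedBall hx', hz⟩, rfl⟩⟩⟩

variable [NormedSpace ℝ F]

/-- The superposition of the translates of the kernel `k` to the points `ι y`, with density `ρ`
with respect to `μ`. -/
def superposition (μ : Measure Y) (ρ : Y → ℝ) (ι : Y → E) (k : E → F) (x : E) : F :=
  ∫ y, ρ y • k (x - ι y) ∂μ

variable [MeasurableSpace E] [BorelSpace E]

theorem aestronglyMeasurable_smul_comp_sub (hK : IsCompact K) (hιm : AEMeasurable ι μ)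
    (hι : ∀ᵐ y ∂μ, ι y ∈ K) (hρ : AEStronglyMeasurable ρ μ) (hk : ContinuousOn k {0}ᶜ)
    (hx : x ∉ K) : AEStronglyMeasurable (fun y => ρ y • k (x - ι y)) μ := by
  have hcont : ContinuousOn (fun z => k (x - z)) K :=
    hk.comp (by fun_prop) fun z hz hzero => hx (by rwa [sub_eq_zero.1 hzero])
  have hmap : (μ.map ι).restrict K = μ.map ι :=
    Measure.restrict_eq_self_of_ae_mem ((ae_map_iff hιm hK.measurableSet).2 hι)
  have hmeas := hcont.aestronglyMeasurable_of_isCompact (μ := μ.map ι) hK hK.measurableSet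
  exact hρ.smul ((hmap ▸ hmeas).comp_aemeasurable hιm)

variable [ProperSpace E]

theorem integrable_smul_comp_sub (hK : IsCompact K) (hιm : AEMeasurable ι μ)
    (hι : ∀ᵐ y ∂μ, ι y ∈ K) (hρ : Integrable ρ μ) (hk : ContinuousOn k {0}ᶜ) (hx : x ∉ K) :
    Integrable (fun y => ρ y • k (x - ι y)) μ := by
  obtain ⟨r, hr, M, hM⟩ := exists_ball_subset_compl_bound hK hk hx
  refine (hρ.norm.mul_const M).mono'
    (aestronglyMeasurable_smul_comp_sub hK hιm hι hρ.aestronglyMeasurable hk hx) ?_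
  filter_upwards [hι] with y hy
  rw [norm_smul]
  exact mul_le_mul_of_nonneg_left ((hM x (Metric.mem_ball_self hr)).2 _ hy) (norm_nonneg _)

theorem continuousOn_superposition (hK : IsCompact K) (hιm : AEMeasurable ι μ)
    (hι : ∀ᵐ y ∂μ, ι y ∈ K) (hρ : Integrable ρ μ) (hk : ContinuousOn k {0}ᶜ) :
    ContinuousOn (superposition μ ρ ι k) Kᶜ := by
  refine fun x hx => ContinuousAt.continuousWithinAt ?_
  obtain ⟨r, hr, M, hM⟩ := exists_ball_subset_compl_bound hK hk hx
  have hball := Metric.ball_mem_nhds x hr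
  refine continuousAt_of_dominated (bound := fun y => ‖ρ y‖ * M) ?_ ?_ (hρ.norm.mul_const M) ?_
  · filter_upwards [hball] with x' hx' using
      aestronglyMeasurable_smul_comp_sub hK hιm hι hρ.aestronglyMeasurable hk (hM x' hx').1
  · filter_upwards [hball] with x' hx'
    filter_upwards [hι] with y hy
    rw [norm_smul]
    exact mul_le_mul_of_nonneg_left ((hM x' hx').2 _ hy) (norm_nonneg _)
  · filter_upwards [hι] with y hy
    have hne : x - ι y ≠ 0 := fun hzero => hx (by rwa [sub_eq_zero.1 hzero])
    exact (ContinuousAt.comp (f := fun x' => x' - ι y)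
      (hk.continuousAt (isOpen_compl_singleton.mem_nhds hne)) (by fun_prop)).const_smul (ρ y)

variable [NormedSpace ℝ E]

theorem hasFDerivAt_superposition (hK : IsCompact K) (hιm : AEMeasurable ι μ)
    (hι : ∀ᵐ y ∂μ, ι y ∈ K) (hρ : Integrable ρ μ) (hk : ContDiffOn ℝ 1 k {0}ᶜ) (hx : x ∉ K) :
    HasFDerivAt (superposition μ ρ ι k) (superposition μ ρ ι (fderiv ℝ k) x) x := by
  have hk' : ContinuousOn (fderiv ℝ k) {0}ᶜ :=
    hk.continuousOn_fderiv_of_isOpen isOpen_compl_singleton le_rfl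
  obtain ⟨r, hr, M, hM⟩ := exists_ball_subset_compl_bound hK hk' hx
  have hball := Metric.ball_mem_nhds x hr
  refine hasFDerivAt_integral_of_dominated_of_fderiv_le (s := Metric.ball x r)
    (bound := fun y => ‖ρ y‖ * M) (F' := fun x y => ρ y • fderiv ℝ k (x - ι y))
    hball ?_ (integrable_smul_comp_sub hK hιm hι hρ hk.continuousOn hx)
    (aestronglyMeasurable_smul_comp_sub hK hιm hι hρ.aestronglyMeasurable hk' hx) ?_
    (hρ.norm.mul_const M) ?_
  · filter_upwards [hball] with x' hx' using aestronglyMeasurable_smul_comp_sub hK hιm hι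
      hρ.aestronglyMeasurable hk.continuousOn (hM x' hx').1
  · filter_upwards [hι] with y hy x' hx'
    rw [norm_smul]
    exact mul_le_mul_of_nonneg_left ((hM x' hx').2 _ hy) (norm_nonneg _)
  · filter_upwards [hι] with y hy x' hx'
    have hne : x' - ι y ≠ 0 := fun hzero => (hM x' hx').1 (by rwa [sub_eq_zero.1 hzero])
    have hdiff : DifferentiableAt ℝ k (x' - ι y) :=
      (hk.contDiffAt (isOpen_compl_singleton.mem_nhds hne)).differentiableAt one_ne_zero
    exact (hdiff.hasFDerivAt.comp x' ((hasFDerivAt_id x').sub_const (ι y))).const_smul (ρ y)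

end Normed

section ContDiff

universe u

variable {E F : Type u} [NormedAddCommGroup E] [NormedSpace ℝ E] [ProperSpace E]
  [MeasurableSpace E] [BorelSpace E] [NormedAddCommGroup F] [NormedSpace ℝ F] {ι : Y → E}
  {K : Set E} {k : E → F}

theorem contDiffOn_superposition (hK : IsCompact K) (hιm : AEMeasurable ι μ)
    (hι : ∀ᵐ y ∂μ, ι y ∈ K) (hρ : Integrable ρ μ) {n : ℕ} (hk : ContDiffOn ℝ n k {0}ᶜ) :
    ContDiffOn ℝ n (superposition μ ρ ι k) Kᶜ := by
  induction n generalizing F with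
  | zero => exact contDiffOn_zero.2 (continuousOn_superposition hK hιm hι hρ hk.continuousOn)
  | succ n ih =>
    have hderiv : ∀ x ∈ Kᶜ, HasFDerivAt (superposition μ ρ ι k)
        (superposition μ ρ ι (fderiv ℝ k) x) x := fun x hx =>
      hasFDerivAt_superposition hK hιm hι hρ (hk.of_le (by simp)) hx
    push_cast at hk ⊢
    rw [contDiffOn_succ_iff_fderiv_of_isOpen isOpen_compl_singleton] at hk
    rw [contDiffOn_succ_iff_fderiv_of_isOpen hK.isClosed.isOpen_compl]
    exact ⟨fun x hx => (hderiv x hx).differentiableAt.differentiableWithinAt, by simp,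
      (ih hk.2.2).congr fun x hx => (hderiv x hx).fderiv⟩

end ContDiff

section Laplacian

variable [NormedSpace ℝ F] [NormedAddCommGroup E] [InnerProductSpace ℝ E] [FiniteDimensional ℝ E]

theorem laplacian_eq_sum_fderiv_fderiv (f : E → F) (x : E) :
    Laplacian.laplacian f x =
      ∑ i, fderiv ℝ (fderiv ℝ f) x (stdOrthonormalBasis ℝ E i) (stdOrthonormalBasis ℝ E i) := by
  simp only [InnerProductSpace.laplacian_eq_iteratedFDeriv_stdOrthonormalBasis,
    iteratedFDeriv_two_apply, Matrix.cons_val_zero, Matrix.cons_val_one]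

variable [MeasurableSpace E] [BorelSpace E]

theorem laplacian_superposition [CompleteSpace F] (hK : IsCompact K) (hιm : AEMeasurable ι μ)
    (hι : ∀ᵐ y ∂μ, ι y ∈ K) (hρ : Integrable ρ μ) (hk : ContDiffOn ℝ 2 k {0}ᶜ) (hx : x ∉ K) :
    Laplacian.laplacian (superposition μ ρ ι k) x =
      superposition μ ρ ι (Laplacian.laplacian k) x := by
  have hk' : ContDiffOn ℝ 1 (fderiv ℝ k) {0}ᶜ :=
    hk.fderiv_of_isOpen isOpen_compl_singleton (by norm_num)
  have hfirst : fderiv ℝ (superposition μ ρ ι k) =ᶠ[𝓝 x] superposition μ ρ ι (fderiv ℝ k) := by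
    filter_upwards [hK.isClosed.isOpen_compl.mem_nhds hx] with x' hx'
    exact (hasFDerivAt_superposition hK hιm hι hρ (hk.of_le (by norm_num)) hx').fderiv
  have hsecond := hfirst.fderiv_eq.trans (hasFDerivAt_superposition hK hιm hι hρ hk' hx).fderiv
  have hint := integrable_smul_comp_sub hK hιm hι hρ
    (hk'.continuousOn_fderiv_of_isOpen isOpen_compl_singleton le_rfl) hx
  have hint_apply : ∀ v, Integrable (fun y => ρ y • fderiv ℝ (fderiv ℝ k) (x - ι y) v v) μ :=
    fun v => (hint.apply_continuousLinearMap v).apply_continuousLinearMap v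
  rw [laplacian_eq_sum_fderiv_fderiv, hsecond, superposition, superposition]
  simp only [laplacian_eq_sum_fderiv_fderiv, Finset.smul_sum]
  rw [integral_finsetSum _ fun i _ => hint_apply _]
  refine Finset.sum_congr rfl fun i _ => ?_
  rw [ContinuousLinearMap.integral_apply hint,
    ContinuousLinearMap.integral_apply (hint.apply_continuousLinearMap _)]
  rfl

end Laplacian

end Superposition

section Newton

variable {E : Type*} [NormedAddCommGroup E] [InnerProductSpace ℝ E] {v : E}

/-- The kernel `1 / |v|` of the Newtonian potential in space, on an arbitrary Euclidean space; it
takes the junk value `0` at the singularity. -/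
def newton (v : E) : ℝ := ‖v‖⁻¹

/-- The gradient of the Newton kernel. -/
def newtonGrad (v : E) : E := -((‖v‖ ^ 3)⁻¹ • v)

theorem hasFDerivAt_norm_of_ne_zero (hv : v ≠ 0) :
    HasFDerivAt (fun w : E => ‖w‖) (‖v‖⁻¹ • innerSL ℝ v) v := by
  have hsqrt := (hasStrictFDerivAt_norm_sq v).hasFDerivAt.sqrt
    (pow_ne_zero 2 (norm_ne_zero_iff.2 hv))
  simp only [Real.sqrt_sq (norm_nonneg _)] at hsqrt
  refine hsqrt.congr_fderiv ?_
  rw [← Nat.cast_smul_eq_nsmul ℝ, smul_smul]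
  congr 1
  push_cast
  field_simp

theorem hasFDerivAt_inv_norm_pow (n : ℕ) (hv : v ≠ 0) :
    HasFDerivAt (fun w : E => (‖w‖ ^ n)⁻¹) ((-n * (‖v‖ ^ (n + 2))⁻¹) • innerSL ℝ v) v := by
  have hnorm : ‖v‖ ≠ 0 := norm_ne_zero_iff.2 hv
  refine (((hasDerivAt_pow n ‖v‖).inv (pow_ne_zero n hnorm)).comp_hasFDerivAt v
    (hasFDerivAt_norm_of_ne_zero hv)).congr_fderiv ?_
  rw [smul_smul]
  congr 1
  cases n with
  | zero => simp
  | succ n => field_simp; simp only [Nat.add_sub_cancel]; ring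

theorem contDiffOn_newton {n : WithTop ℕ∞} : ContDiffOn ℝ n (newton : E → ℝ) {0}ᶜ := fun _ hv =>
  ((contDiffAt_norm ℝ hv).inv (norm_ne_zero_iff.2 hv)).contDiffWithinAt

theorem continuousOn_newtonGrad : ContinuousOn (newtonGrad : E → E) {0}ᶜ :=
  ((ContinuousOn.inv₀ (by fun_prop) fun _ hv =>
    pow_ne_zero 3 (norm_ne_zero_iff.2 hv)).smul continuousOn_id).neg

theorem hasFDerivAt_newton (hv : v ≠ 0) : HasFDerivAt newton (innerSL ℝ (newtonGrad v)) v := by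
  have hinv := hasFDerivAt_inv_norm_pow 1 hv
  simp only [pow_one] at hinv
  refine hinv.congr_fderiv ?_
  rw [newtonGrad, map_neg, map_smul, Nat.cast_one, neg_one_mul, neg_smul]

theorem hasFDerivAt_newtonGrad (hv : v ≠ 0) :
    HasFDerivAt newtonGrad ((3 * (‖v‖ ^ 5)⁻¹) • (innerSL ℝ v).smulRight v -
      (‖v‖ ^ 3)⁻¹ • ContinuousLinearMap.id ℝ E) v := by
  refine ((hasFDerivAt_inv_norm_pow 3 hv).smul (hasFDerivAt_id v)).neg.congr_fderiv ?_
  ext w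
  simp only [Nat.cast_ofNat, add_apply, sub_apply, smul_apply, neg_apply,
    ContinuousLinearMap.smulRight_apply, ContinuousLinearMap.id_apply, id_eq]
  module

theorem fderiv_fderiv_newton_apply (hv : v ≠ 0) (w w' : E) :
    fderiv ℝ (fderiv ℝ newton) v w w' =
      3 * (‖v‖ ^ 5)⁻¹ * inner ℝ v w * inner ℝ v w' - (‖v‖ ^ 3)⁻¹ * inner ℝ w w' := by
  have hfirst : (fun x => fderiv ℝ newton x w') =ᶠ[𝓝 v] fun x => inner ℝ (newtonGrad x) w' := by
    filter_upwards [isOpen_compl_singleton.mem_nhds hv] with x hx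
    rw [(hasFDerivAt_newton hx).fderiv, innerSL_apply_apply]
  have hdiff : DifferentiableAt ℝ (fderiv ℝ newton) v :=
    ((contDiffOn_newton (n := 2)).fderiv_of_isOpen (m := 1) isOpen_compl_singleton
      (by norm_num)).differentiableOn one_ne_zero |>.differentiableAt
      (isOpen_compl_singleton.mem_nhds hv)
  have hsecond := (((hasFDerivAt_newtonGrad hv).inner ℝ
    (hasFDerivAt_const w' v)).congr_of_eventuallyEq hfirst).unique
    (hdiff.hasFDerivAt.clm_apply (hasFDerivAt_const w' v))
  calc fderiv ℝ (fderiv ℝ newton) v w w'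
      = inner ℝ ((3 * (‖v‖ ^ 5)⁻¹) • inner ℝ v w • v - (‖v‖ ^ 3)⁻¹ • w) w' := by
        simpa using (DFunLike.congr_fun hsecond w).symm
    _ = _ := by
        rw [inner_sub_left, real_inner_smul_left, real_inner_smul_left, real_inner_smul_left,
          ← mul_assoc]

theorem laplacian_newton [FiniteDimensional ℝ E] (hv : v ≠ 0) :
    Laplacian.laplacian (newton : E → ℝ) v = (3 - Module.finrank ℝ E) * (‖v‖ ^ 3)⁻¹ := by
  have hnorm : ‖v‖ ≠ 0 := norm_ne_zero_iff.2 hv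
  simp only [laplacian_eq_sum_fderiv_fderiv, fderiv_fderiv_newton_apply hv, mul_assoc, ← sq,
    real_inner_self_eq_norm_sq, OrthonormalBasis.norm_eq_one, one_pow, mul_one]
  rw [Finset.sum_sub_distrib, ← Finset.mul_sum, ← Finset.mul_sum,
    (stdOrthonormalBasis ℝ E).sum_sq_inner_left, Finset.sum_const, Finset.card_univ,
    Fintype.card_fin, nsmul_eq_mul]
  field_simp

end Newton

section SingleLayer

theorem lift3_sub_lift3 (y z : EuclideanSpace ℝ (Fin 2)) (s t : ℝ) :
    lift3 y s - lift3 z t = lift3 (y - z) (s - t) :=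
  (lift3Equiv.map_sub (y, s) (z, t)).symm

theorem norm_lift3_sq (y : EuclideanSpace ℝ (Fin 2)) (s : ℝ) :
    ‖lift3 y s‖ ^ 2 = ‖y‖ ^ 2 + s ^ 2 := by
  simp [EuclideanSpace.norm_sq_eq, Fin.sum_univ_three, Fin.sum_univ_two, lift3]

theorem norm_lift3_zero (y : EuclideanSpace ℝ (Fin 2)) : ‖lift3 y 0‖ = ‖y‖ := by
  rw [← sq_eq_sq₀ (norm_nonneg _) (norm_nonneg _), norm_lift3_sq, zero_pow two_ne_zero, add_zero]

theorem norm_lift3_neg (y : EuclideanSpace ℝ (Fin 2)) (s : ℝ) : ‖lift3 y (-s)‖ = ‖lift3 y s‖ := by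
  rw [← sq_eq_sq₀ (norm_nonneg _) (norm_nonneg _), norm_lift3_sq, norm_lift3_sq, neg_sq]

theorem norm_le_norm_lift3 (y : EuclideanSpace ℝ (Fin 2)) (s : ℝ) : ‖y‖ ≤ ‖lift3 y s‖ := by
  refine le_of_sq_le_sq ?_ (norm_nonneg _)
  rw [norm_lift3_sq]
  exact le_add_of_nonneg_right (sq_nonneg s)

theorem continuous_lift3_zero : Continuous fun y => lift3 y 0 :=
  continuous_lift3.comp (continuous_id.prodMk continuous_const)

variable {A : Set (EuclideanSpace ℝ (Fin 2))} {ρ : EuclideanSpace ℝ (Fin 2) → ℝ}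
  {x : EuclideanSpace ℝ (Fin 3)} {y : EuclideanSpace ℝ (Fin 2)}

/-- The closure of the plane set `A`, as a subset of space; it carries the sources of a layer on
`A`. -/
def layerSupport (A : Set (EuclideanSpace ℝ (Fin 2))) : Set (EuclideanSpace ℝ (Fin 3)) :=
  (fun y => lift3 y 0) '' closure A

theorem isCompact_layerSupport (hA : Bornology.IsBounded A) : IsCompact (layerSupport A) :=
  hA.isCompact_closure.image continuous_lift3_zero

theorem lift3_mem_layerSupport_iff {s : ℝ} :
    lift3 y s ∈ layerSupport A ↔ y ∈ closure A ∧ s = 0 := by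
  refine ⟨?_, fun h => ⟨y, h.1, by rw [h.2]⟩⟩
  rintro ⟨z, hz, heq⟩
  obtain ⟨rfl, rfl⟩ := Prod.mk.inj (lift3Equiv.injective heq : (z, (0 : ℝ)) = (y, s))
  exact ⟨hz, rfl⟩

theorem notMem_layerSupport (hx : x 2 ≠ 0) : x ∉ layerSupport A := by
  rintro ⟨y, _, rfl⟩
  exact hx rfl

theorem ae_lift3_mem_layerSupport (hAm : MeasurableSet A) :
    ∀ᵐ y ∂volume.restrict A, lift3 y 0 ∈ layerSupport A := by
  filter_upwards [ae_restrict_mem hAm] with y hy using ⟨y, subset_closure hy, rfl⟩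

theorem singleLayer_eq_smul_superposition : singleLayer A ρ =
    (1 / (2 * Real.pi)) • superposition (volume.restrict A) ρ (fun y => lift3 y 0) newton := rfl

theorem harmonicOnNhd_singleLayer (hA : Bornology.IsBounded A) (hAm : MeasurableSet A)
    (hρ : IntegrableOn ρ A) :
    InnerProductSpace.HarmonicOnNhd (singleLayer A ρ) (layerSupport A)ᶜ := by
  intro x hx
  have hK := isCompact_layerSupport hA
  have hι := ae_lift3_mem_layerSupport hAm
  have hιm : AEMeasurable (fun y => lift3 y 0) (volume.restrict A) :=
    continuous_lift3_zero.aemeasurable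
  have hnhds := hK.isClosed.isOpen_compl.mem_nhds hx
  rw [singleLayer_eq_smul_superposition]
  refine InnerProductSpace.HarmonicAt.const_smul ⟨(contDiffOn_superposition hK hιm hι hρ
    (n := 2) contDiffOn_newton).contDiffAt hnhds, ?_⟩
  filter_upwards [hnhds] with x' hx'
  rw [laplacian_superposition hK hιm hι hρ contDiffOn_newton hx', superposition]
  refine (integral_congr_ae ?_).trans (integral_zero _ _)
  filter_upwards [hι] with y hy
  have hne : x' - lift3 y 0 ≠ 0 := fun hzero => hx' (by rwa [sub_eq_zero.1 hzero])
  rw [laplacian_newton hne, finrank_euclideanSpace_fin, Nat.cast_ofNat, sub_self, zero_mul,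
    smul_zero]

theorem gradient_singleLayer (hA : Bornology.IsBounded A) (hAm : MeasurableSet A)
    (hρ : IntegrableOn ρ A) (hx : x ∉ layerSupport A) : ∇ (singleLayer A ρ) x =
      (1 / (2 * Real.pi)) • ∫ y in A, ρ y • newtonGrad (x - lift3 y 0) := by
  have hK := isCompact_layerSupport hA
  have hι := ae_lift3_mem_layerSupport hAm
  have hιm : AEMeasurable (fun y => lift3 y 0) (volume.restrict A) :=
    continuous_lift3_zero.aemeasurable
  have hfderiv : superposition (volume.restrict A) ρ (fun y => lift3 y 0) (fderiv ℝ newton) x =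
      InnerProductSpace.toDual ℝ _ (∫ y in A, ρ y • newtonGrad (x - lift3 y 0)) := by
    refine Eq.trans (integral_congr_ae ?_)
      ((InnerProductSpace.toDual ℝ _).toContinuousLinearEquiv.integral_comp_comm _)
    filter_upwards [hι] with y hy
    have hne : x - lift3 y 0 ≠ 0 := fun hzero => hx (by rwa [sub_eq_zero.1 hzero])
    rw [(hasFDerivAt_newton hne).fderiv]
    exact ((InnerProductSpace.toDual ℝ _).map_smulₛₗ (ρ y) _).symm
  refine HasGradientAt.gradient ?_
  rw [hasGradientAt_iff_hasFDerivAt, singleLayer_eq_smul_superposition, map_smul, ← hfderiv]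
  exact (hasFDerivAt_superposition hK hιm hι hρ contDiffOn_newton hx).const_smul _

theorem singleLayer_lift3_neg (y : EuclideanSpace ℝ (Fin 2)) (s : ℝ) :
    singleLayer A ρ (lift3 y (-s)) = singleLayer A ρ (lift3 y s) := by
  simp only [singleLayer, lift3_sub_lift3, sub_zero, norm_lift3_neg]

theorem hasDerivAt_zero_of_even {f : ℝ → ℝ} (hf : f.Even) (hd : DifferentiableAt ℝ f 0) :
    HasDerivAt f 0 0 := by
  have hzero : deriv f 0 = 0 := by
    simpa only [hf _, neg_zero, self_eq_neg] using deriv_comp_neg f 0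
  exact hd.hasDerivAt.congr_deriv hzero

theorem hasDerivAt_singleLayer_lift3 (hA : Bornology.IsBounded A) (hAm : MeasurableSet A)
    (hρ : IntegrableOn ρ A) (hy : y ∉ closure A) :
    HasDerivAt (fun s : ℝ => singleLayer A ρ (lift3 y s)) 0 0 := by
  have hx : lift3 y 0 ∉ layerSupport A := fun h => hy (lift3_mem_layerSupport_iff.1 h).1
  have hlift : DifferentiableAt ℝ (fun s : ℝ => lift3 y s) 0 :=
    lift3Equiv.differentiableAt.comp (f := fun s : ℝ => (y, s)) 0 (by fun_prop)
  exact hasDerivAt_zero_of_even (singleLayer_lift3_neg y)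
    (((harmonicOnNhd_singleLayer hA hAm hρ _ hx).1.differentiableAt two_ne_zero).comp 0 hlift)

end SingleLayer

section BoundaryValues

variable {f : EuclideanSpace ℝ (Fin 2) → ℝ}

theorem integrableOn_inv_norm_closedBall (R : ℝ) :
    IntegrableOn (fun v : EuclideanSpace ℝ (Fin 2) => ‖v‖⁻¹) (Metric.closedBall 0 R) := by
  refine IntegrableOn.mono_set ?_ (Metric.closedBall_subset_ball (lt_add_one R))
  rw [integrableOn_fun_norm_addHaar volume (f := fun r : ℝ => r⁻¹), finrank_euclideanSpace_fin]
  refine (integrableOn_const (μ := volume) (s := Ioo 0 (R + 1)) (C := (1 : ℝ))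
    measure_Ioo_lt_top.ne).congr_fun (fun r hr => ?_) measurableSet_Ioo
  simp only [pow_one, smul_eq_mul, Nat.add_one_sub_one, mul_inv_cancel₀ hr.1.ne']

theorem exists_integrable_bound_div_norm_lift3 (hf : Continuous f) (hfc : HasCompactSupport f)
    (p₀ : EuclideanSpace ℝ (Fin 2) × ℝ) : ∃ B : EuclideanSpace ℝ (Fin 2) → ℝ, Integrable B ∧
      ∀ᶠ p in 𝓝 p₀, ∀ v ≠ 0, ‖f (p.1 - v) / ‖lift3 v p.2‖‖ ≤ B v := by
  obtain ⟨C, hC⟩ := hf.bounded_above_of_compact_support hfc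
  obtain ⟨R, hR⟩ := hfc.isCompact.isBounded.subset_closedBall p₀.1
  refine ⟨(Metric.closedBall 0 (1 + R)).indicator fun v => C * ‖v‖⁻¹,
    (integrable_indicator_iff Metric.isClosed_closedBall.measurableSet).2
      ((integrableOn_inv_norm_closedBall _).const_mul C), ?_⟩
  filter_upwards [continuous_fst.continuousAt.preimage_mem_nhds
    (Metric.closedBall_mem_nhds p₀.1 one_pos)] with p hp v hv
  by_cases hvR : v ∈ Metric.closedBall (0 : EuclideanSpace ℝ (Fin 2)) (1 + R)
  · rw [indicator_of_mem hvR, norm_div, norm_norm, div_eq_mul_inv]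
    exact mul_le_mul (hC _) (inv_anti₀ (norm_pos_iff.2 hv) (norm_le_norm_lift3 v p.2))
      (inv_nonneg.2 (norm_nonneg _)) ((norm_nonneg _).trans (hC 0))
  · suffices hzero : f (p.1 - v) = 0 by
      rw [indicator_of_notMem hvR, hzero, zero_div, norm_zero]
    refine image_eq_zero_of_notMem_tsupport fun hmem => hvR ?_
    rw [mem_closedBall_zero_iff]
    calc ‖v‖ = ‖(p.1 - p₀.1) - (p.1 - v - p₀.1)‖ := by congr 1; abel
      _ ≤ ‖p.1 - p₀.1‖ + ‖p.1 - v - p₀.1‖ := norm_sub_le _ _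
      _ ≤ 1 + R := add_le_add (mem_closedBall_iff_norm.1 hp) (mem_closedBall_iff_norm.1 (hR hmem))

theorem aestronglyMeasurable_sub_div_norm_lift3 (hf : Continuous f)
    (p : EuclideanSpace ℝ (Fin 2) × ℝ) :
    AEStronglyMeasurable (fun v => f (p.1 - v) / ‖lift3 v p.2‖) volume := by
  refine Measurable.aestronglyMeasurable (Measurable.div ?_ ?_)
  · exact (hf.comp (continuous_const.sub continuous_id)).measurable
  · exact (continuous_lift3.comp (continuous_id.prodMk continuous_const)).norm.measurable

theorem integral_div_norm_lift3_sub (p : EuclideanSpace ℝ (Fin 2) × ℝ) :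
    ∫ y, f y / ‖lift3 p.1 p.2 - lift3 y 0‖ = ∫ v, f (p.1 - v) / ‖lift3 v p.2‖ := by
  rw [← integral_sub_left_eq_self _ volume p.1]
  simp only [lift3_sub_lift3, sub_sub_cancel, sub_zero]

theorem integrable_div_norm_of_hasCompactSupport (hf : Continuous f) (hfc : HasCompactSupport f)
    (x : EuclideanSpace ℝ (Fin 3)) : Integrable fun y => f y / ‖x - lift3 y 0‖ := by
  obtain ⟨p, rfl⟩ := lift3Equiv.surjective x
  obtain ⟨B, hB, hle⟩ := exists_integrable_bound_div_norm_lift3 hf hfc p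
  rw [← integrable_comp_sub_left _ p.1]
  simp only [lift3Equiv_apply, lift3_sub_lift3, sub_sub_cancel, sub_zero]
  refine hB.mono' (aestronglyMeasurable_sub_div_norm_lift3 hf p) ?_
  filter_upwards [Measure.ae_ne volume (0 : EuclideanSpace ℝ (Fin 2))] with v hv
    using hle.self_of_nhds v hv

theorem continuous_singleLayer_univ (hf : Continuous f) (hfc : HasCompactSupport f) :
    Continuous (singleLayer univ f) := by
  suffices h : Continuous fun p : EuclideanSpace ℝ (Fin 2) × ℝ =>
      ∫ v, f (p.1 - v) / ‖lift3 v p.2‖ by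
    simp only [← integral_div_norm_lift3_sub] at h
    refine lift3Equiv.toHomeomorph.comp_continuous_iff'.1 ((h.const_mul (1 / (2 * Real.pi))).congr
      fun p => ?_)
    rw [Function.comp_apply, singleLayer, setIntegral_univ]
    rfl
  refine continuous_iff_continuousAt.2 fun p₀ => ?_
  obtain ⟨B, hB, hle⟩ := exists_integrable_bound_div_norm_lift3 hf hfc p₀
  have hne := Measure.ae_ne volume (0 : EuclideanSpace ℝ (Fin 2))
  refine continuousAt_of_dominated
    (.of_forall (aestronglyMeasurable_sub_div_norm_lift3 hf)) ?_ hB ?_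
  · filter_upwards [hle] with p hp
    filter_upwards [hne] with v hv using hp v hv
  · filter_upwards [hne] with v hv
    have hpos : 0 < ‖lift3 v p₀.2‖ := (norm_pos_iff.2 hv).trans_le (norm_le_norm_lift3 v p₀.2)
    refine ContinuousAt.div (by fun_prop) ?_ hpos.ne'
    exact (continuous_lift3.comp (continuous_const.prodMk continuous_snd)).norm.continuousAt

variable {A : Set (EuclideanSpace ℝ (Fin 2))} {y₀ : EuclideanSpace ℝ (Fin 2)}

theorem continuousAt_singleLayer_of_notMem_closure (hA : Bornology.IsBounded A)
    (hAm : MeasurableSet A) (hf : IntegrableOn f A) (hy₀ : y₀ ∉ closure A) :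
    ContinuousAt (singleLayer A f) (lift3 y₀ 0) :=
  (harmonicOnNhd_singleLayer hA hAm hf _ fun h =>
    hy₀ (lift3_mem_layerSupport_iff.1 h).1).1.continuousAt

theorem integrableOn_div_norm_lift3_sub (hA : Bornology.IsBounded A)
    (hAm : MeasurableSet A) (hf : IntegrableOn f A) {x : EuclideanSpace ℝ (Fin 3)}
    (hx : x ∉ layerSupport A) :
    IntegrableOn (fun y => f y / ‖x - lift3 y 0‖) A :=
  integrable_smul_comp_sub (isCompact_layerSupport hA) continuous_lift3_zero.aemeasurable
    (ae_lift3_mem_layerSupport hAm) hf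
    (contDiffOn_newton (n := 0)).continuousOn hx

theorem singleLayer_eq_of_subset {B : Set (EuclideanSpace ℝ (Fin 2))} (hAB : A ⊆ B)
    (hBm : MeasurableSet B) (hf : ∀ y ∈ B \ A, f y = 0) : singleLayer A f = singleLayer B f := by
  ext x
  rw [singleLayer, singleLayer, setIntegral_eq_of_subset_of_forall_sdiff_eq_zero hBm hAB
    fun y hy => by rw [hf y hy, zero_div]]

theorem singleLayer_add {g : EuclideanSpace ℝ (Fin 2) → ℝ} {x : EuclideanSpace ℝ (Fin 3)}
    (hf : IntegrableOn (fun y => f y / ‖x - lift3 y 0‖) A)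
    (hg : IntegrableOn (fun y => g y / ‖x - lift3 y 0‖) A) :
    singleLayer A (f + g) x = singleLayer A f x + singleLayer A g x := by
  simp only [singleLayer, Pi.add_apply, add_div, integral_add hf hg, mul_add]

theorem exists_hasCompactSupport_eqOn_ball (hA : IsOpen A) (hfc : ContinuousOn f A)
    (hy₀ : y₀ ∈ A) : ∃ g : EuclideanSpace ℝ (Fin 2) → ℝ, Continuous g ∧ HasCompactSupport g ∧
      (∀ y ∉ A, g y = 0) ∧ ∃ r > 0, EqOn g f (Metric.ball y₀ r) := by
  obtain ⟨R, hR, hRA⟩ := Metric.nhds_basis_closedBall.mem_iff.1 (hA.mem_nhds hy₀)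
  let χ : ContDiffBump y₀ := ⟨R / 2, R, half_pos hR, half_lt_self hR⟩
  have hsupp : tsupport (⇑χ * f) ⊆ A :=
    (tsupport_mul_subset_left.trans χ.tsupport_eq.subset).trans hRA
  refine ⟨⇑χ * f, (χ.continuous.continuousOn.mul hfc).continuous_of_tsupport_subset hA hsupp,
    χ.hasCompactSupport.mul_right,
    fun y hy => image_eq_zero_of_notMem_tsupport fun h => hy (hsupp h),
    R / 2, half_pos hR, fun y hy => ?_⟩
  rw [Pi.mul_apply, χ.one_of_mem_closedBall (Metric.ball_subset_closedBall hy), one_mul]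

theorem continuousAt_singleLayer (hA : IsOpen A) (hAb : Bornology.IsBounded A)
    (hf : IntegrableOn f A) (hfc : ContinuousOn f A) (hy₀ : y₀ ∈ A) :
    ContinuousAt (singleLayer A f) (lift3 y₀ 0) := by
  obtain ⟨near, hcont, hcompact, hzero, r, hr, heq⟩ :=
    exists_hasCompactSupport_eqOn_ball hA hfc hy₀
  let B := A \ Metric.ball y₀ r
  have hBm : MeasurableSet B := hA.measurableSet.diff measurableSet_ball
  have hBb : Bornology.IsBounded B := hAb.subset sdiff_subset
  have hy₀_far : y₀ ∉ closure B := fun h =>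
    closure_minimal (fun _ hy => hy.2) Metric.isOpen_ball.isClosed_compl h (Metric.mem_ball_self hr)
  have hfar : IntegrableOn (f - near) A :=
    hf.sub (hcont.integrable_of_hasCompactSupport hcompact).integrableOn
  have hnear_univ : singleLayer A near = singleLayer univ near :=
    singleLayer_eq_of_subset (subset_univ A) .univ fun y hy => hzero y hy.2
  have hfar_zero : ∀ y ∈ A \ B, (f - near) y = 0 := fun y hy =>
    sub_eq_zero.2 (heq (not_not.1 fun h => hy.2 ⟨hy.1, h⟩)).symm
  have hfar_B : singleLayer B (f - near) = singleLayer A (f - near) :=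
    singleLayer_eq_of_subset sdiff_subset hA.measurableSet hfar_zero
  have hsum : ContinuousAt (singleLayer A near + singleLayer A (f - near)) (lift3 y₀ 0) := by
    rw [hnear_univ, ← hfar_B]
    exact (continuous_singleLayer_univ hcont hcompact).continuousAt.add
      (continuousAt_singleLayer_of_notMem_closure hBb hBm (hfar.mono_set sdiff_subset) hy₀_far)
  refine hsum.congr ?_
  filter_upwards [(isCompact_layerSupport hBb).isClosed.isOpen_compl.mem_nhds fun h =>
    hy₀_far (lift3_mem_layerSupport_iff.1 h).1] with x hx
  have hfar_kernel : IntegrableOn (fun y => (f - near) y / ‖x - lift3 y 0‖) A := by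
    refine (integrableOn_div_norm_lift3_sub hBb hBm (hfar.mono_set sdiff_subset)
      hx).of_forall_sdiff_eq_zero hA.measurableSet fun y hy => ?_
    rw [hfar_zero y hy, zero_div]
  rw [Pi.add_apply, ← singleLayer_add
    (integrable_div_norm_of_hasCompactSupport hcont hcompact x).integrableOn hfar_kernel,
    add_sub_cancel]

theorem solvesApertureProblem_singleLayer {g : EuclideanSpace ℝ (Fin 2) → ℝ}
    (hA : IsOpen A) (hAb : Bornology.IsBounded A) (hf : IntegrableOn f A)
    (hfc : ContinuousOn f A) (hg : ∀ y ∈ A, 1 / (2 * Real.pi) * ∫ z in A, f z / ‖y - z‖ = g y) :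
    SolvesApertureProblem A g (singleLayer A f) where
  harmonic _ hx := harmonicOnNhd_singleLayer hAb hA.measurableSet hf _ (notMem_layerSupport hx)
  neumann _ hy := hasDerivAt_singleLayer_lift3 hAb hA.measurableSet hf hy
  continuousAt _ hy := continuousAt_singleLayer hA hAb hf hfc hy
  dirichlet y hy := by
    simp only [← hg y hy, singleLayer, lift3_sub_lift3, sub_self, norm_lift3_zero]

end BoundaryValues

section Interaction

/-- A radial majorant of the interaction of two sources at distance `d`. -/
def majorant (d : ℝ) (v : EuclideanSpace ℝ (Fin 3)) : ℝ :=
  (‖v‖ ^ 2 * (‖v‖ ^ 2 + d ^ 2))⁻¹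

theorem majorant_nonneg (d : ℝ) (v : EuclideanSpace ℝ (Fin 3)) : 0 ≤ majorant d v := by
  unfold majorant
  positivity

theorem integrable_majorant_one : Integrable (majorant 1) := by
  refine (integrable_fun_norm_addHaar volume
    (f := fun r : ℝ => (r ^ 2 * (r ^ 2 + 1 ^ 2))⁻¹)).2 ?_
  rw [finrank_euclideanSpace_fin]
  refine integrable_inv_one_add_sq.integrableOn.congr_fun (fun r hr => ?_) measurableSet_Ioi
  have hr_ne : r ≠ 0 := (mem_Ioi.1 hr).ne'
  rw [Nat.add_one_sub_one, smul_eq_mul, one_pow, mul_inv, mul_inv_cancel_left₀ (by positivity),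
    add_comm]

variable {d : ℝ}

theorem majorant_eq_smul (hd : 0 < d) :
    majorant d = fun v => (d ^ 4)⁻¹ * majorant 1 (d⁻¹ • v) := by
  ext v
  rw [majorant, majorant, ← mul_inv, norm_smul, norm_inv, Real.norm_of_nonneg hd.le]
  congr 1
  field_simp

theorem integrable_majorant (hd : 0 < d) : Integrable (majorant d) := by
  rw [majorant_eq_smul hd]
  exact (integrable_majorant_one.comp_smul (inv_ne_zero hd.ne')).const_mul _

theorem integral_majorant (hd : 0 < d) : ∫ v, majorant d v = (∫ v, majorant 1 v) / d := by
  rw [majorant_eq_smul hd, integral_const_mul, Measure.integral_comp_smul,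
    finrank_euclideanSpace_fin, inv_pow, inv_inv, abs_of_pos (by positivity), smul_eq_mul]
  field_simp

theorem inv_sq_mul_inv_sq_le {s t : ℝ} (hs : 0 < s) (ht : 0 < t) (hd : 0 ≤ d) (hst : d ≤ s + t) :
    (s ^ 2)⁻¹ * (t ^ 2)⁻¹ ≤ 3 * ((s ^ 2 * (s ^ 2 + d ^ 2))⁻¹ + (t ^ 2 * (t ^ 2 + d ^ 2))⁻¹) := by
  have hd_sq : d ^ 2 ≤ 2 * (s ^ 2 + t ^ 2) := by
    nlinarith [pow_le_pow_left₀ hd hst 2, sq_nonneg (s - t)]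
  have hs_le : (s ^ 2 + t ^ 2)⁻¹ ≤ 3 * (s ^ 2 + d ^ 2)⁻¹ := by
    rw [← div_eq_mul_inv, inv_eq_one_div, div_le_div_iff₀ (by positivity) (by positivity)]
    linarith [sq_nonneg t]
  have ht_le : (s ^ 2 + t ^ 2)⁻¹ ≤ 3 * (t ^ 2 + d ^ 2)⁻¹ := by
    rw [← div_eq_mul_inv, inv_eq_one_div, div_le_div_iff₀ (by positivity) (by positivity)]
    linarith [sq_nonneg s]
  calc (s ^ 2)⁻¹ * (t ^ 2)⁻¹
      = (s ^ 2)⁻¹ * (s ^ 2 + t ^ 2)⁻¹ + (t ^ 2)⁻¹ * (s ^ 2 + t ^ 2)⁻¹ := by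
        field_simp
        ring
    _ ≤ (s ^ 2)⁻¹ * (3 * (s ^ 2 + d ^ 2)⁻¹) + (t ^ 2)⁻¹ * (3 * (t ^ 2 + d ^ 2)⁻¹) := by gcongr
    _ = _ := by
        rw [mul_inv, mul_inv]
        ring

section InnerProductSpace

variable {E : Type*} [NormedAddCommGroup E] [InnerProductSpace ℝ E]

theorem norm_newtonGrad (v : E) : ‖newtonGrad v‖ = (‖v‖ ^ 2)⁻¹ := by
  rw [newtonGrad, norm_neg, norm_smul, norm_inv, norm_pow, norm_norm]
  rcases eq_or_ne ‖v‖ 0 with hv | hv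
  · rw [hv, mul_zero, zero_pow two_ne_zero, inv_zero]
  · field_simp

theorem newtonGrad_neg (v : E) : newtonGrad (-v) = -newtonGrad v := by
  rw [newtonGrad, newtonGrad, norm_neg, smul_neg]

/-- The energy density at `x` of the interaction of unit sources at `p` and `q`. -/
def interaction (p q x : E) : ℝ := inner ℝ (newtonGrad (x - p)) (newtonGrad (x - q))

theorem interaction_neg (p q x : E) : interaction p q (-x) = interaction (-p) (-q) x := by
  have hsub : ∀ p : E, -x - p = -(x - -p) := fun p => by abel
  rw [interaction, interaction, hsub, hsub, newtonGrad_neg, newtonGrad_neg, inner_neg_neg]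

theorem interaction_add (p q v : E) :
    interaction p q (p + v) = inner ℝ (newtonGrad v) (newtonGrad (v - (q - p))) := by
  rw [interaction, add_sub_cancel_left, add_comm p v, add_sub_assoc, ← neg_sub q p,
    ← sub_eq_add_neg]

theorem measurable_interaction [MeasurableSpace E] [BorelSpace E] [SecondCountableTopology E] :
    Measurable fun p : E × E × E => interaction p.1 p.2.1 p.2.2 := by
  unfold interaction newtonGrad
  fun_prop

end InnerProductSpace

theorem norm_interaction_le (p q x : EuclideanSpace ℝ (Fin 3)) : ‖interaction p q x‖ ≤
    3 * (majorant ‖p - q‖ (x - p) + majorant ‖p - q‖ (x - q)) := by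
  refine (norm_inner_le_norm _ _).trans ?_
  have hrhs : 0 ≤ 3 * (majorant ‖p - q‖ (x - p) + majorant ‖p - q‖ (x - q)) :=
    mul_nonneg zero_le_three (add_nonneg (majorant_nonneg _ _) (majorant_nonneg _ _))
  have htri : ‖p - q‖ ≤ ‖x - p‖ + ‖x - q‖ := by
    rw [norm_sub_rev x p]
    exact norm_sub_le_norm_sub_add_norm_sub p x q
  rw [norm_newtonGrad, norm_newtonGrad]
  rcases eq_or_ne x p with rfl | hp
  · rwa [sub_self, norm_zero, zero_pow two_ne_zero, inv_zero, zero_mul, ← sub_self x]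
  rcases eq_or_ne x q with rfl | hq
  · rwa [sub_self, norm_zero, zero_pow two_ne_zero, inv_zero, mul_zero, ← sub_self x]
  exact inv_sq_mul_inv_sq_le (norm_sub_pos_iff.2 hp) (norm_sub_pos_iff.2 hq) (norm_nonneg _) htri

variable {p q : EuclideanSpace ℝ (Fin 3)}

theorem integrable_interaction (hpq : p ≠ q) : Integrable (interaction p q) := by
  have hm := integrable_majorant (norm_sub_pos_iff.2 hpq)
  refine (((hm.comp_sub_right p).add (hm.comp_sub_right q)).const_mul 3).mono' ?_
    (.of_forall (norm_interaction_le p q))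
  exact (measurable_interaction.comp (measurable_const.prodMk
    (measurable_const.prodMk measurable_id))).aestronglyMeasurable

theorem integral_norm_interaction_le (hpq : p ≠ q) :
    ∫ x, ‖interaction p q x‖ ≤ 6 * (∫ v, majorant 1 v) / ‖p - q‖ := by
  have hd := norm_sub_pos_iff.2 hpq
  have hm := integrable_majorant hd
  calc ∫ x, ‖interaction p q x‖
      ≤ ∫ x, 3 * (majorant ‖p - q‖ (x - p) + majorant ‖p - q‖ (x - q)) :=
        integral_mono (integrable_interaction hpq).norm
          (((hm.comp_sub_right p).add (hm.comp_sub_right q)).const_mul 3) (norm_interaction_le p q)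
    _ = 6 * (∫ v, majorant 1 v) / ‖p - q‖ := by
        rw [integral_const_mul, integral_add (hm.comp_sub_right _) (hm.comp_sub_right _),
          integral_sub_right_eq_self (majorant ‖p - q‖),
          integral_sub_right_eq_self (majorant ‖p - q‖), integral_majorant hd]
        ring

end Interaction

section Rays

variable {E : Type*} [NormedAddCommGroup E] [InnerProductSpace ℝ E] {v w : E}

theorem hasDerivAt_newton_ray {h : ℝ} (hne : h • v - w ≠ 0) :
    HasDerivAt (fun h : ℝ => newton (h • v - w)) (inner ℝ v (newtonGrad (h • v - w))) h := by
  rw [real_inner_comm]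
  refine (hasFDerivAt_newton hne).comp_hasDerivAt (f := fun h : ℝ => h • v - w) h ?_
  simpa only [id, one_smul] using ((hasDerivAt_id h).smul_const v).sub_const w

theorem tendsto_newton_ray (hv : v ≠ 0) :
    Tendsto (fun h : ℝ => newton (h • v - w)) atTop (𝓝 0) := by
  refine Tendsto.inv_tendsto_atTop (tendsto_atTop_mono (fun h => ?_)
    (tendsto_atTop_add_const_right _ (-‖w‖)
      (tendsto_id.atTop_mul_const (norm_pos_iff.2 hv))))
  calc h * ‖v‖ + -‖w‖ ≤ ‖h • v‖ - ‖w‖ := by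
        rw [norm_smul, ← sub_eq_add_neg]
        gcongr
        exact Real.le_norm_self h
    _ ≤ ‖h • v - w‖ := norm_sub_norm_le _ _

theorem sq_mul_inner_newtonGrad_smul {h : ℝ} (hh : 0 < h) (hv : v ≠ 0) (x : E) :
    h ^ 2 * inner ℝ (newtonGrad (h • v)) x = -(‖v‖ ^ 3)⁻¹ * inner ℝ v x := by
  rw [newtonGrad, inner_neg_left, real_inner_smul_left, real_inner_smul_left, norm_smul,
    Real.norm_of_nonneg hh.le]
  field_simp [norm_ne_zero_iff.2 hv]

theorem integral_ray_interaction (hv : v ≠ 0) (hne : ∀ h : ℝ, 0 ≤ h → h • v - w ≠ 0)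
    (hi : IntegrableOn (fun h : ℝ => h ^ 2 * inner ℝ (newtonGrad (h • v)) (newtonGrad (h • v - w)))
      (Ioi 0)) :
    ∫ h in Ioi (0 : ℝ), h ^ 2 * inner ℝ (newtonGrad (h • v)) (newtonGrad (h • v - w)) =
      (‖v‖ ^ 3)⁻¹ * newton w := by
  have hderiv : EqOn (fun h : ℝ => h ^ 2 * inner ℝ (newtonGrad (h • v)) (newtonGrad (h • v - w)))
      (fun h => -(‖v‖ ^ 3)⁻¹ * inner ℝ v (newtonGrad (h • v - w))) (Ioi 0) := fun h hh =>
    sq_mul_inner_newtonGrad_smul hh hv _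
  rw [setIntegral_congr_fun measurableSet_Ioi hderiv,
    integral_Ioi_of_hasDerivAt_of_tendsto'
      (fun h hh => (hasDerivAt_newton_ray (hne h hh)).const_mul _)
      (hi.congr_fun hderiv measurableSet_Ioi) ((tendsto_newton_ray hv).const_mul _),
    zero_smul, zero_sub, mul_zero, zero_sub, newton, newton, norm_neg, neg_mul, neg_neg]

end Rays

section HalfSpaces

theorem hasDerivAt_neg_inv_sqrt_sq_add_one (r : ℝ) :
    HasDerivAt (fun r : ℝ => -(√(r ^ 2 + 1))⁻¹) (r * (√(r ^ 2 + 1) ^ 3)⁻¹) r := by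
  have hpos : 0 < √(r ^ 2 + 1) := Real.sqrt_pos.2 (by positivity)
  refine ((((hasDerivAt_pow 2 r).add_const 1).sqrt (by positivity)).inv
    hpos.ne').neg.congr_deriv ?_
  rw [Nat.cast_ofNat, Nat.add_one_sub_one, pow_one]
  field_simp

theorem tendsto_neg_inv_sqrt_sq_add_one :
    Tendsto (fun r : ℝ => -(√(r ^ 2 + 1))⁻¹) atTop (𝓝 0) := by
  rw [← neg_zero]
  exact (Real.tendsto_sqrt_atTop.comp (tendsto_atTop_add_const_right _ _
    (tendsto_pow_atTop two_ne_zero))).inv_tendsto_atTop.neg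

theorem integral_inv_norm_lift3_one_cube :
    ∫ u : EuclideanSpace ℝ (Fin 2), (‖lift3 u 1‖ ^ 3)⁻¹ = 2 * Real.pi := by
  have hradial : ∀ u, (‖lift3 u 1‖ ^ 3)⁻¹ = (√(‖u‖ ^ 2 + 1) ^ 3)⁻¹ := fun u => by
    rw [← Real.sqrt_sq (norm_nonneg (lift3 u 1)), norm_lift3_sq, one_pow]
  have hIoi : ∫ r in Ioi (0 : ℝ), r * (√(r ^ 2 + 1) ^ 3)⁻¹ = 1 := by
    rw [integral_Ioi_of_hasDerivAt_of_nonneg' (fun r _ => hasDerivAt_neg_inv_sqrt_sq_add_one r)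
      (fun r hr => mul_nonneg (mem_Ioi.1 hr).le (by positivity)) tendsto_neg_inv_sqrt_sq_add_one,
      zero_pow two_ne_zero, zero_add, Real.sqrt_one, inv_one, sub_neg_eq_add, zero_add]
  have hdisk : (volume : Measure (EuclideanSpace ℝ (Fin 2))).real (Metric.ball 0 1) = Real.pi := by
    rw [measureReal_def, EuclideanSpace.volume_ball_fin_two, ENNReal.ofReal_one, one_pow, one_mul,
      ENNReal.toReal_ofReal Real.pi_nonneg]
  simp only [hradial]
  rw [integral_fun_norm_addHaar volume (fun r : ℝ => (√(r ^ 2 + 1) ^ 3)⁻¹), hdisk]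
  simp only [finrank_euclideanSpace_fin, Nat.add_one_sub_one, pow_one, smul_eq_mul, hIoi,
    nsmul_eq_mul, Nat.cast_ofNat, mul_one]

theorem measurableSet_upperHalfSpace : MeasurableSet upperHalfSpace :=
  (isOpen_lt continuous_const (by fun_prop)).measurableSet

theorem measurableSet_lowerHalfSpace : MeasurableSet lowerHalfSpace :=
  (isOpen_lt (by fun_prop) continuous_const).measurableSet

variable {y z : EuclideanSpace ℝ (Fin 2)}

theorem add_smul_lift3_mem_upperHalfSpace_iff (u : EuclideanSpace ℝ (Fin 2)) (h : ℝ) :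
    lift3 y 0 + h • lift3 u 1 ∈ upperHalfSpace ↔ 0 < h := by
  simp [upperHalfSpace, lift3]

theorem smul_lift3_sub_ne_zero (hy : y ≠ 0) (u : EuclideanSpace ℝ (Fin 2)) (h : ℝ) :
    h • lift3 u 1 - lift3 y 0 ≠ 0 := by
  intro heq
  have hh : h = 0 := by simpa [lift3] using congrArg (· 2) heq
  rw [hh, zero_smul, zero_sub, neg_eq_zero, ← norm_eq_zero, norm_lift3_zero] at heq
  exact hy (norm_eq_zero.1 heq)

theorem sq_smul_indicator_interaction_cone (u : EuclideanSpace ℝ (Fin 2)) (h : ℝ) :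
    |h| ^ 2 • upperHalfSpace.indicator (interaction (lift3 y 0) (lift3 z 0))
      (lift3 y 0 + h • lift3 u 1) =
    (Ioi 0).indicator (fun h => h ^ 2 * inner ℝ (newtonGrad (h • lift3 u 1))
      (newtonGrad (h • lift3 u 1 - lift3 (z - y) 0))) h := by
  by_cases hh : 0 < h
  · rw [indicator_of_mem ((add_smul_lift3_mem_upperHalfSpace_iff u h).2 hh),
      indicator_of_mem (mem_Ioi.2 hh), interaction_add, lift3_sub_lift3, sub_self, sq_abs,
      smul_eq_mul]
  · rw [indicator_of_notMem (mt (add_smul_lift3_mem_upperHalfSpace_iff u h).1 hh),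
      indicator_of_notMem (mt mem_Ioi.1 hh), smul_zero]

theorem lift3_zero_injective : Function.Injective fun y => lift3 y 0 := fun _ _ h =>
  (Prod.mk.inj (lift3Equiv.injective h)).1

theorem integral_upperHalfSpace_interaction (hyz : y ≠ z) :
    ∫ x in upperHalfSpace, interaction (lift3 y 0) (lift3 z 0) x = 2 * Real.pi / ‖y - z‖ := by
  have hint : Integrable (upperHalfSpace.indicator (interaction (lift3 y 0) (lift3 z 0))) :=
    (integrable_interaction (lift3_zero_injective.ne hyz)).indicator measurableSet_upperHalfSpace
  have hcone := (integrable_iff_cone measurePreserving_lift3Equiv (lift3 y 0)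
    hint.aestronglyMeasurable).1 hint
  rw [← integral_indicator measurableSet_upperHalfSpace,
    integral_eq_cone measurePreserving_lift3Equiv (lift3 y 0) hint.aestronglyMeasurable,
    integral_prod _ hcone, norm_sub_rev, ← integral_inv_norm_lift3_one_cube, ← integral_div]
  refine integral_congr_ae ?_
  filter_upwards [hcone.prod_right_ae] with u hu
  simp only [finrank_euclideanSpace_fin, lift3Equiv_apply,
    sq_smul_indicator_interaction_cone] at hu ⊢
  rw [integrable_indicator_iff measurableSet_Ioi] at hu
  rw [integral_indicator measurableSet_Ioi, integral_ray_interaction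
    (fun h => one_ne_zero (congrArg (· 2) h))
    (fun h _ => smul_lift3_sub_ne_zero (sub_ne_zero.2 hyz.symm) u h) hu, newton, norm_lift3_zero,
    div_eq_mul_inv]

theorem neg_lift3_zero (y : EuclideanSpace ℝ (Fin 2)) : -lift3 y 0 = lift3 (-y) 0 := by
  simpa only [lift3Equiv_apply, Prod.neg_mk, neg_zero] using (lift3Equiv.map_neg (y, 0)).symm

theorem integral_lowerHalfSpace_interaction (hyz : y ≠ z) :
    ∫ x in lowerHalfSpace, interaction (lift3 y 0) (lift3 z 0) x = 2 * Real.pi / ‖y - z‖ := by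
  have hpre : (Neg.neg : EuclideanSpace ℝ (Fin 3) → _) ⁻¹' upperHalfSpace = lowerHalfSpace := by
    ext x
    exact neg_pos (a := x 2)
  have hneg : ∀ x, interaction (lift3 y 0) (lift3 z 0) x =
      interaction (lift3 (-y) 0) (lift3 (-z) 0) (-x) := fun x => by
    rw [interaction_neg, neg_lift3_zero, neg_lift3_zero, neg_neg, neg_neg]
  simp only [hneg]
  rw [← hpre, (Measure.measurePreserving_neg volume).setIntegral_preimage_emb
    (MeasurableEquiv.neg _).measurableEmbedding,
    integral_upperHalfSpace_interaction (neg_injective.ne hyz), neg_sub_neg, norm_sub_rev]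

end HalfSpaces

section DirichletEnergy

theorem ae_prod_fst_ne_snd {α : Type*} [MeasurableSpace α] [MeasurableEq α] (μ ν : Measure α)
    [SFinite ν] [NullSingletonClass ν] : ∀ᵐ p ∂(μ.prod ν), p.1 ≠ p.2 := by
  refine (Measure.ae_prod_iff_ae_ae (measurableSet_eq_fun measurable_fst measurable_snd).compl).2
    (.of_forall fun y => ?_)
  filter_upwards [Measure.ae_ne ν y] with z hz using hz.symm

variable {A : Set (EuclideanSpace ℝ (Fin 2))} {ρ : EuclideanSpace ℝ (Fin 2) → ℝ}
  {U : Set (EuclideanSpace ℝ (Fin 3))}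

/-- The contribution at `x` of the pair of sources at `p.1` and `p.2` to the energy density of the
layer with density `ρ`. -/
def layerInteraction (ρ : EuclideanSpace ℝ (Fin 2) → ℝ) (x : EuclideanSpace ℝ (Fin 3))
    (p : EuclideanSpace ℝ (Fin 2) × EuclideanSpace ℝ (Fin 2)) : ℝ :=
  ρ p.1 * ρ p.2 * interaction (lift3 p.1 0) (lift3 p.2 0) x

theorem layerInteraction_eq_inner (x : EuclideanSpace ℝ (Fin 3))
    (y z : EuclideanSpace ℝ (Fin 2)) : layerInteraction ρ x (y, z) =
      inner ℝ (ρ y • newtonGrad (x - lift3 y 0)) (ρ z • newtonGrad (x - lift3 z 0)) := by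
  rw [real_inner_smul_left, real_inner_smul_right, ← mul_assoc]
  rfl

theorem measurable_layerInteraction (hρ : Measurable ρ) : Measurable fun q :
    EuclideanSpace ℝ (Fin 3) × EuclideanSpace ℝ (Fin 2) × EuclideanSpace ℝ (Fin 2) =>
      layerInteraction ρ q.1 q.2 := by
  have hlift := continuous_lift3_zero.measurable
  unfold layerInteraction interaction newtonGrad
  fun_prop

theorem integral_norm_layerInteraction_le {p : EuclideanSpace ℝ (Fin 2) × EuclideanSpace ℝ (Fin 2)}
    (hp : p.1 ≠ p.2) : ∫ x in U, ‖layerInteraction ρ x p‖ ≤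
      ‖ρ p.1 * ρ p.2 / ‖p.1 - p.2‖‖ * (6 * ∫ v, majorant 1 v) := by
  have hne := lift3_zero_injective.ne hp
  have hnorm : ‖lift3 p.1 0 - lift3 p.2 0‖ = ‖p.1 - p.2‖ := by
    rw [lift3_sub_lift3, sub_self, norm_lift3_zero]
  have hle : ∫ x in U, ‖interaction (lift3 p.1 0) (lift3 p.2 0) x‖ ≤
      6 * (∫ v, majorant 1 v) / ‖p.1 - p.2‖ := by
    rw [← hnorm]
    exact (setIntegral_le_integral (integrable_interaction hne).norm
      (.of_forall fun x => norm_nonneg _)).trans (integral_norm_interaction_le hne)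
  simp only [layerInteraction, norm_mul (ρ p.1 * ρ p.2)]
  rw [integral_const_mul, norm_div, norm_norm]
  calc _ ≤ ‖ρ p.1 * ρ p.2‖ * (6 * (∫ v, majorant 1 v) / ‖p.1 - p.2‖) := by gcongr
    _ = _ := by ring

theorem integrable_layerInteraction (hρm : Measurable ρ)
    (hpair : Integrable (fun p => ρ p.1 * ρ p.2 / ‖p.1 - p.2‖)
      ((volume.restrict A).prod (volume.restrict A))) :
    Integrable (fun q : EuclideanSpace ℝ (Fin 3) × EuclideanSpace ℝ (Fin 2) ×
      EuclideanSpace ℝ (Fin 2) => layerInteraction ρ q.1 q.2)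
      ((volume.restrict U).prod ((volume.restrict A).prod (volume.restrict A))) := by
  have hm := (measurable_layerInteraction hρm).aestronglyMeasurable
    (μ := (volume.restrict U).prod ((volume.restrict A).prod (volume.restrict A)))
  have hne := ae_prod_fst_ne_snd (volume.restrict A) (volume.restrict A)
  refine (integrable_prod_iff' hm).2 ⟨?_, ?_⟩
  · filter_upwards [hne] with p hp
    exact (integrable_interaction (lift3_zero_injective.ne hp)).integrableOn.const_mul _
  · refine (hpair.norm.mul_const (6 * ∫ v, majorant 1 v)).mono'
      hm.norm.prod_swap.integral_prod_right' ?_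
    filter_upwards [hne] with p hp
    rw [Real.norm_of_nonneg (integral_nonneg fun x => norm_nonneg _)]
    exact integral_norm_layerInteraction_le hp

theorem norm_gradient_singleLayer_sq (hA : Bornology.IsBounded A) (hAm : MeasurableSet A)
    (hρ : IntegrableOn ρ A) {x : EuclideanSpace ℝ (Fin 3)} (hx : x ∉ layerSupport A)
    (hi : Integrable (layerInteraction ρ x) ((volume.restrict A).prod (volume.restrict A))) :
    ‖∇ (singleLayer A ρ) x‖ ^ 2 = (1 / (2 * Real.pi)) ^ 2 *
      ∫ p, layerInteraction ρ x p ∂((volume.restrict A).prod (volume.restrict A)) := by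
  have hgrad := integrable_smul_comp_sub (isCompact_layerSupport hA)
    continuous_lift3_zero.aemeasurable (ae_lift3_mem_layerSupport hAm) hρ continuousOn_newtonGrad hx
  rw [gradient_singleLayer hA hAm hρ hx, norm_smul, mul_pow, Real.norm_eq_abs, sq_abs,
    ← real_inner_self_eq_norm_sq, integral_prod _ hi, ← integral_inner hgrad]
  simp only [layerInteraction_eq_inner, integral_inner hgrad, real_inner_comm]

theorem hasDirichletEnergy_singleLayer (hA : Bornology.IsBounded A) (hAm : MeasurableSet A)
    (hρm : Measurable ρ) (hρ : IntegrableOn ρ A)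
    (hpair : Integrable (fun p => ρ p.1 * ρ p.2 / ‖p.1 - p.2‖)
      ((volume.restrict A).prod (volume.restrict A)))
    (hUm : MeasurableSet U) (hU : ∀ x ∈ U, x 2 ≠ 0)
    (hinter : ∀ y z, y ≠ z →
      ∫ x in U, interaction (lift3 y 0) (lift3 z 0) x = 2 * Real.pi / ‖y - z‖) :
    HasDirichletEnergy (singleLayer A ρ) U (1 / (2 * Real.pi) *
      ∫ p, ρ p.1 * ρ p.2 / ‖p.1 - p.2‖ ∂((volume.restrict A).prod (volume.restrict A))) := by
  have hi := integrable_layerInteraction (U := U) hρm hpair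
  have hnorm : (fun x => ‖∇ (singleLayer A ρ) x‖ ^ 2) =ᵐ[volume.restrict U] fun x =>
      (1 / (2 * Real.pi)) ^ 2 *
        ∫ p, layerInteraction ρ x p ∂((volume.restrict A).prod (volume.restrict A)) := by
    filter_upwards [hi.prod_right_ae, ae_restrict_mem hUm] with x hx hxU
    exact norm_gradient_singleLayer_sq hA hAm hρ (notMem_layerSupport (hU x hxU)) hx
  refine ⟨(hi.integral_prod_left.const_mul _).congr hnorm.symm, ?_⟩
  rw [integral_congr_ae hnorm, integral_const_mul, ← integral_prod _ hi, integral_prod_symm _ hi,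
    ← integral_const_mul, ← integral_const_mul]
  refine integral_congr_ae ?_
  filter_upwards [ae_prod_fst_ne_snd (volume.restrict A) (volume.restrict A)] with p hp
  simp only [layerInteraction]
  rw [integral_const_mul, hinter _ _ hp]
  field_simp

theorem integrable_prod_div_norm_sub (hAm : MeasurableSet A) (hρm : Measurable ρ)
    (hρ : IntegrableOn ρ A) {C : ℝ} (hi : ∀ y ∈ A, IntegrableOn (fun z => ρ z / ‖y - z‖) A)
    (hC : ∀ y ∈ A, ∫ z in A, ‖ρ z / ‖y - z‖‖ ≤ C) :
    Integrable (fun p => ρ p.1 * ρ p.2 / ‖p.1 - p.2‖)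
      ((volume.restrict A).prod (volume.restrict A)) := by
  have hm : AEStronglyMeasurable (fun p : EuclideanSpace ℝ (Fin 2) × EuclideanSpace ℝ (Fin 2) =>
      ρ p.1 * ρ p.2 / ‖p.1 - p.2‖) ((volume.restrict A).prod (volume.restrict A)) :=
    (Measurable.div (by fun_prop) (by fun_prop)).aestronglyMeasurable
  refine (integrable_prod_iff hm).2
    ⟨?_, (hρ.norm.mul_const C).mono' hm.norm.integral_prod_right' ?_⟩
    <;> filter_upwards [ae_restrict_mem hAm] with y hy
  · simpa only [mul_div_assoc] using (hi y hy).const_mul (ρ y)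
  · rw [Real.norm_of_nonneg (integral_nonneg fun x => norm_nonneg _)]
    simp only [mul_div_assoc, norm_mul (ρ y), integral_const_mul]
    exact mul_le_mul_of_nonneg_left (hC y hy) (norm_nonneg _)

theorem integral_prod_div_norm_sub (hAm : MeasurableSet A)
    (hpair : Integrable (fun p => ρ p.1 * ρ p.2 / ‖p.1 - p.2‖)
      ((volume.restrict A).prod (volume.restrict A))) {g : EuclideanSpace ℝ (Fin 2) → ℝ}
    (hg : ∀ y ∈ A, 1 / (2 * Real.pi) * ∫ z in A, ρ z / ‖y - z‖ = g y) :
    1 / (2 * Real.pi) *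
      ∫ p, ρ p.1 * ρ p.2 / ‖p.1 - p.2‖ ∂((volume.restrict A).prod (volume.restrict A)) =
      ∫ y in A, ρ y * g y := by
  rw [integral_prod _ hpair, ← integral_const_mul]
  refine setIntegral_congr_fun hAm fun y hy => ?_
  simp only [mul_div_assoc, integral_const_mul, ← hg y hy, mul_left_comm]

theorem hasDirichletEnergy_of_potential (hA : Bornology.IsBounded A) (hAm : MeasurableSet A)
    (hρm : Measurable ρ) (hρ : IntegrableOn ρ A) {C : ℝ}
    (hi : ∀ y ∈ A, IntegrableOn (fun z => ρ z / ‖y - z‖) A)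
    (hC : ∀ y ∈ A, ∫ z in A, ‖ρ z / ‖y - z‖‖ ≤ C) {g : EuclideanSpace ℝ (Fin 2) → ℝ}
    (hg : ∀ y ∈ A, 1 / (2 * Real.pi) * ∫ z in A, ρ z / ‖y - z‖ = g y) :
    HasDirichletEnergy (singleLayer A ρ) upperHalfSpace (∫ y in A, ρ y * g y) ∧
      HasDirichletEnergy (singleLayer A ρ) lowerHalfSpace (∫ y in A, ρ y * g y) := by
  have hpair := integrable_prod_div_norm_sub hAm hρm hρ hi hC
  rw [← integral_prod_div_norm_sub hAm hpair hg]
  exact ⟨hasDirichletEnergy_singleLayer hA hAm hρm hρ hpair measurableSet_upperHalfSpace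
      (fun _ hx => hx.ne') fun _ _ => integral_upperHalfSpace_interaction,
    hasDirichletEnergy_singleLayer hA hAm hρm hρ hpair measurableSet_lowerHalfSpace
      (fun _ hx => hx.ne) fun _ _ => integral_lowerHalfSpace_interaction⟩

end DirichletEnergy

section EllipticDisk

variable {a b : ℝ}

theorem isOpen_ellipticDisk : IsOpen (ellipticDisk a b) :=
  isOpen_lt (by fun_prop) continuous_const

theorem isBounded_ellipticDisk (hb : 0 < b) (hab : b ≤ a) :
    Bornology.IsBounded (ellipticDisk a b) := by
  have ha := hb.trans_le hab
  refine Metric.isBounded_closedBall (x := (0 : EuclideanSpace ℝ (Fin 2))) (r := a) |>.subset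
    fun y hy => mem_closedBall_zero_iff.2 (le_of_sq_le_sq ?_ ha.le)
  have hlt : (y 0 ^ 2 + y 1 ^ 2) / a ^ 2 < 1 :=
    calc (y 0 ^ 2 + y 1 ^ 2) / a ^ 2 = y 0 ^ 2 / a ^ 2 + y 1 ^ 2 / a ^ 2 := add_div _ _ _
      _ ≤ y 0 ^ 2 / a ^ 2 + y 1 ^ 2 / b ^ 2 := by gcongr
      _ < 1 := hy
  rw [EuclideanSpace.norm_sq_eq, Fin.sum_univ_two, Real.norm_eq_abs, Real.norm_eq_abs, sq_abs,
    sq_abs]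
  exact ((div_lt_one (by positivity)).1 hlt).le

section Moments

theorem profile_slice (s t : ℝ) : profile a b !₂[s, t] =
    (√((1 - s ^ 2 / a ^ 2) - 1 / b ^ 2 * (t - 0) ^ 2))⁻¹ := by
  simp only [profile, Matrix.cons_val_zero, Matrix.cons_val_one]
  congr 2
  ring

theorem one_sub_sq_div_sq_pos (ha : 0 < a) {s : ℝ} (hs : s ∈ Ioo (-a) a) :
    0 < 1 - s ^ 2 / a ^ 2 :=
  sub_pos.2 ((div_lt_one (by positivity)).2 (sq_lt_sq' hs.1 hs.2))

theorem profile_slice_eq_zero (ha : 0 < a) {s : ℝ} (hs : s ∉ Ioo (-a) a) (t : ℝ) :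
    profile a b !₂[s, t] = 0 :=
  profile_eq_zero fun hmem => hs (abs_lt.1 (abs_coord_lt ha hmem))

theorem integrable_profile_slice (ha : 0 < a) (hb : 0 < b) (s : ℝ) :
    Integrable fun t : ℝ => profile a b !₂[s, t] := by
  by_cases hs : s ∈ Ioo (-a) a
  · simp_rw [profile_slice]
    exact integrable_inv_sqrt_sub_mul_sq (one_sub_sq_div_sq_pos ha hs) (by positivity) 0
  · simp only [profile_slice_eq_zero ha hs]
    exact integrable_zero _ _ _

theorem integral_profile_slice (ha : 0 < a) (hb : 0 < b) (s : ℝ) :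
    ∫ t : ℝ, profile a b !₂[s, t] = (Ioo (-a) a).indicator (fun _ => Real.pi * b) s := by
  by_cases hs : s ∈ Ioo (-a) a
  · simp_rw [profile_slice]
    rw [integral_inv_sqrt_sub_mul_sq (one_sub_sq_div_sq_pos ha hs) (by positivity) 0,
      indicator_of_mem hs, ← one_div_pow, Real.sqrt_sq (by positivity), div_div_eq_mul_div, div_one]
  · simp only [profile_slice_eq_zero ha hs, integral_zero, indicator_of_notMem hs]

theorem integrable_profile (ha : 0 < a) (hb : 0 < b) : Integrable (profile a b) := by
  rw [← measurePreserving_planeEquiv.integrable_comp_emb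
    planeEquiv.toHomeomorph.measurableEmbedding]
  refine (integrable_prod_iff
    (measurable_profile.comp planeEquiv.continuous.measurable).aestronglyMeasurable).2
    ⟨.of_forall fun s => integrable_profile_slice ha hb s, ?_⟩
  simp only [Function.comp_apply, planeEquiv_apply, Real.norm_of_nonneg (profile_nonneg _),
    integral_profile_slice ha hb]
  exact (integrable_indicator_iff measurableSet_Ioo).2 (integrableOn_const (by simp))

theorem integrable_comp_coord_mul_profile (ha : 0 < a) (hb : 0 < b) {g : ℝ → ℝ}
    (hg : Continuous g) :
    Integrable fun y : EuclideanSpace ℝ (Fin 2) => g (y 0) * profile a b y := by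
  obtain ⟨C, hC⟩ := isCompact_Icc.exists_bound_of_continuousOn (s := Icc (-a) a) hg.continuousOn
  refine ((integrable_profile ha hb).const_mul C).mono'
    (Measurable.aestronglyMeasurable (by fun_prop)) (.of_forall fun y => ?_)
  by_cases hy : y ∈ ellipticDisk a b
  · rw [norm_mul, Real.norm_of_nonneg (profile_nonneg y)]
    exact mul_le_mul_of_nonneg_right (hC _ (abs_le.1 (abs_coord_lt ha hy).le)) (profile_nonneg y)
  · rw [profile_eq_zero hy, mul_zero, mul_zero, norm_zero]

theorem integral_comp_coord_mul_profile (ha : 0 < a) (hb : 0 < b) {g : ℝ → ℝ}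
    (hg : Continuous g) : ∫ y : EuclideanSpace ℝ (Fin 2), g (y 0) * profile a b y =
      Real.pi * b * ∫ s in (-a)..a, g s := by
  have hi := integrable_comp_coord_mul_profile ha hb hg
  rw [← measurePreserving_planeEquiv.integrable_comp_emb
    planeEquiv.toHomeomorph.measurableEmbedding] at hi
  rw [← measurePreserving_planeEquiv.integral_comp
    planeEquiv.toHomeomorph.measurableEmbedding]
  calc ∫ p : ℝ × ℝ, g (planeEquiv p 0) * profile a b (planeEquiv p)
      = ∫ s : ℝ, ∫ t : ℝ, g s * profile a b !₂[s, t] := integral_prod _ hi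
    _ = ∫ s : ℝ, (Ioo (-a) a).indicator (fun s => Real.pi * b * g s) s := by
        congr with s
        rw [integral_const_mul, integral_profile_slice ha hb, mul_comm]
        exact (indicator_mul_left _ (fun _ => Real.pi * b) g).symm
    _ = _ := by
        rw [integral_indicator measurableSet_Ioo, integral_const_mul,
          ← integral_Ioc_eq_integral_Ioo, ← intervalIntegral.integral_of_le (by linarith)]

end Moments

variable {α β : ℝ} {U : Set (EuclideanSpace ℝ (Fin 3))}

theorem integrable_affineDensity (ha : 0 < a) (hb : 0 < b) :
    Integrable (affineDensity a b α β) :=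
  integrable_comp_coord_mul_profile ha hb (g := fun s => α + β * s) (by fun_prop)

theorem integral_affine_mul_affine (c α β γ δ : ℝ) :
    ∫ s in (-c)..c, (α + β * s) * (γ + δ * s) = 2 * c * (α * γ) + 2 / 3 * c ^ 3 * (β * δ) := by
  have hexpand : ∀ s : ℝ, (α + β * s) * (γ + δ * s) =
      α * γ + (α * δ + β * γ) * s + β * δ * s ^ 2 := fun s => by ring
  simp only [hexpand]
  rw [intervalIntegral.integral_add (Continuous.intervalIntegrable (by fun_prop) _ _)
      (Continuous.intervalIntegrable (by fun_prop) _ _),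
    intervalIntegral.integral_add (Continuous.intervalIntegrable (by fun_prop) _ _)
      (Continuous.intervalIntegrable (by fun_prop) _ _), intervalIntegral.integral_const,
    intervalIntegral.integral_const_mul, intervalIntegral.integral_const_mul, integral_id,
    integral_pow, smul_eq_mul]
  push_cast
  ring

theorem integral_affineDensity_mul_affine (ha : 0 < a) (hb : 0 < b) (γ δ : ℝ) :
    ∫ y in ellipticDisk a b, affineDensity a b α β y * (γ + δ * y 0) =
      Real.pi * b * (2 * a * (α * γ) + 2 / 3 * a ^ 3 * (β * δ)) := by
  rw [setIntegral_eq_integral_of_forall_compl_eq_zero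
      fun y hy => by rw [affineDensity_eq_zero hy, zero_mul],
    ← integral_affine_mul_affine,
    ← integral_comp_coord_mul_profile ha hb (g := fun s => (α + β * s) * (γ + δ * s))
      (by fun_prop)]
  simp only [affineDensity, mul_right_comm]

theorem potential_affineDensity (hb : 0 < b) (hab : b ≤ a) {x : EuclideanSpace ℝ (Fin 2)}
    (hx : x ∈ ellipticDisk a b) :
    1 / (2 * Real.pi) * ∫ y in ellipticDisk a b, affineDensity a b α β y / ‖x - y‖ =
      b * α * ellipticK (eccentricity a b) + b * β * ellipticD (eccentricity a b) * x 0 := by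
  rw [setIntegral_eq_integral_of_forall_compl_eq_zero
      fun y hy => by rw [affineDensity_eq_zero hy, zero_div],
    integral_affineDensity_div_norm hb hab hx]
  field_simp

theorem solvesApertureProblem_affineDensity (hb : 0 < b) (hab : b ≤ a) :
    SolvesApertureProblem (ellipticDisk a b)
      (fun y => b * α * ellipticK (eccentricity a b) + b * β * ellipticD (eccentricity a b) * y 0)
      (singleLayer (ellipticDisk a b) (affineDensity a b α β)) :=
  solvesApertureProblem_singleLayer isOpen_ellipticDisk (isBounded_ellipticDisk hb hab)
    (integrable_affineDensity (hb.trans_le hab) hb).integrableOn continuousOn_affineDensity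
    fun _ hy => potential_affineDensity hb hab hy

theorem hasDirichletEnergy_affineDensity (hb : 0 < b) (hab : b ≤ a)
    (hU : U = upperHalfSpace ∨ U = lowerHalfSpace) :
    HasDirichletEnergy (singleLayer (ellipticDisk a b) (affineDensity a b α β)) U
      (Real.pi * b ^ 2 * (2 * a * α ^ 2 * ellipticK (eccentricity a b) +
        2 / 3 * a ^ 3 * β ^ 2 * ellipticD (eccentricity a b))) := by
  have ha := hb.trans_le hab
  have henergy := hasDirichletEnergy_of_potential (isBounded_ellipticDisk hb hab)
    isOpen_ellipticDisk.measurableSet measurable_affineDensity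
    (integrable_affineDensity (α := α) (β := β) ha hb).integrableOn
    (fun y hy => (integrable_affineDensity_div_norm ha hb hy).integrableOn)
    (fun y hy => setIntegral_norm_affineDensity_div_norm_le hb hab hy)
    (fun y hy => potential_affineDensity hb hab hy)
  have hvalue : ∫ y in ellipticDisk a b, affineDensity a b α β y *
      (b * α * ellipticK (eccentricity a b) + b * β * ellipticD (eccentricity a b) * y 0) =
      Real.pi * b ^ 2 * (2 * a * α ^ 2 * ellipticK (eccentricity a b) +
        2 / 3 * a ^ 3 * β ^ 2 * ellipticD (eccentricity a b)) := by
    rw [integral_affineDensity_mul_affine ha hb]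
    ring
  rw [hvalue] at henergy
  rcases hU with rfl | rfl
  exacts [henergy.1, henergy.2]

end EllipticDisk

section Aperture

variable {a b : ℝ} {U : Set (EuclideanSpace ℝ (Fin 3))} {x : EuclideanSpace ℝ (Fin 2)}

theorem mul_inv_mul_ellipticK_eccentricity (hb : 0 < b) (hab : b ≤ a) :
    b * (b * ellipticK (eccentricity a b))⁻¹ * ellipticK (eccentricity a b) = 1 := by
  rw [mul_right_comm]
  exact mul_inv_cancel₀ (mul_pos hb (ellipticK_pos (eccentricity_sq_lt_one hb hab))).ne'

theorem mul_inv_mul_ellipticD_eccentricity (hb : 0 < b) (hab : b ≤ a) :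
    b * (b * ellipticD (eccentricity a b))⁻¹ * ellipticD (eccentricity a b) = 1 := by
  rw [mul_right_comm]
  exact mul_inv_cancel₀ (mul_pos hb (ellipticD_pos (eccentricity_sq_lt_one hb hab))).ne'

theorem integrable_rhoW_div_norm (ha : 0 < a) (hb : 0 < b) (hx : x ∈ ellipticDisk a b) :
    Integrable fun y => rhoW a b y / ‖x - y‖ :=
  rhoW_eq_affineDensity ▸ integrable_affineDensity_div_norm ha hb hx

theorem integrable_rhoT_div_norm (ha : 0 < a) (hb : 0 < b) (hx : x ∈ ellipticDisk a b) :
    Integrable fun y => rhoT a b y / ‖x - y‖ :=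
  rhoT_eq_affineDensity ▸ integrable_affineDensity_div_norm ha hb hx

theorem potential_rhoW (hb : 0 < b) (hab : b ≤ a) (hx : x ∈ ellipticDisk a b) :
    1 / (2 * Real.pi) * ∫ y in ellipticDisk a b, rhoW a b y / ‖x - y‖ = 1 := by
  rw [rhoW_eq_affineDensity, potential_affineDensity hb hab hx,
    mul_inv_mul_ellipticK_eccentricity hb hab, mul_zero, zero_mul, zero_mul, add_zero]

theorem potential_rhoT (hb : 0 < b) (hab : b ≤ a) (hx : x ∈ ellipticDisk a b) :
    1 / (2 * Real.pi) * ∫ y in ellipticDisk a b, rhoT a b y / ‖x - y‖ = x 0 := by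
  rw [rhoT_eq_affineDensity, potential_affineDensity hb hab hx,
    mul_inv_mul_ellipticD_eccentricity hb hab, mul_zero, zero_mul, zero_add, one_mul]

theorem solvesApertureProblem_potW (hb : 0 < b) (hab : b ≤ a) :
    SolvesApertureProblem (ellipticDisk a b) (fun _ => 1) (potW a b) := by
  simpa only [potW, rhoW_eq_affineDensity, mul_inv_mul_ellipticK_eccentricity hb hab, mul_zero,
    zero_mul, add_zero] using solvesApertureProblem_affineDensity
      (α := (b * ellipticK (eccentricity a b))⁻¹) (β := 0) hb hab

theorem solvesApertureProblem_potT (hb : 0 < b) (hab : b ≤ a) :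
    SolvesApertureProblem (ellipticDisk a b) (fun y => y 0) (potT a b) := by
  simpa only [potT, rhoT_eq_affineDensity, mul_inv_mul_ellipticD_eccentricity hb hab, mul_zero,
    zero_mul, zero_add, one_mul] using solvesApertureProblem_affineDensity
      (α := 0) (β := (b * ellipticD (eccentricity a b))⁻¹) hb hab

theorem hasDirichletEnergy_potW (hb : 0 < b) (hab : b ≤ a)
    (hU : U = upperHalfSpace ∨ U = lowerHalfSpace) :
    HasDirichletEnergy (potW a b) U
      (4 * a * (ellipticK 0 / ellipticK (eccentricity a b))) := by
  have hK := ellipticK_pos (eccentricity_sq_lt_one hb hab)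
  rw [potW, rhoW_eq_affineDensity]
  convert hasDirichletEnergy_affineDensity hb hab hU using 1
  rw [ellipticK_zero]
  field_simp
  ring

theorem hasDirichletEnergy_potT (hb : 0 < b) (hab : b ≤ a)
    (hU : U = upperHalfSpace ∨ U = lowerHalfSpace) :
    HasDirichletEnergy (potT a b) U
      (8 / 3 * a ^ 3 * (ellipticD 0 / ellipticD (eccentricity a b))) := by
  have hD := ellipticD_pos (eccentricity_sq_lt_one hb hab)
  rw [potT, rhoT_eq_affineDensity]
  convert hasDirichletEnergy_affineDensity hb hab hU using 1
  rw [ellipticD_zero]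
  field_simp
  ring

end Aperture

end EllipticAperture

end

theorem mainTheorem2 (a b : ℝ) (hb : 0 < b) (hab : b ≤ a) :
    -- the single-layer integral of `ρ_w` converges and is equal to `1` on the elliptic disk
    (∀ x ∈ EllipticAperture.ellipticDisk a b,
      MeasureTheory.IntegrableOn (fun y => EllipticAperture.rhoW a b y / ‖x - y‖)
        (EllipticAperture.ellipticDisk a b) ∧
      1 / (2 * Real.pi) * ∫ y in EllipticAperture.ellipticDisk a b,
        EllipticAperture.rhoW a b y / ‖x - y‖ = 1) ∧
    -- the single-layer integral of `ρ_t` converges and is equal to `x₁` on the elliptic disk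
    (∀ x ∈ EllipticAperture.ellipticDisk a b,
      MeasureTheory.IntegrableOn (fun y => EllipticAperture.rhoT a b y / ‖x - y‖)
        (EllipticAperture.ellipticDisk a b) ∧
      1 / (2 * Real.pi) * ∫ y in EllipticAperture.ellipticDisk a b,
        EllipticAperture.rhoT a b y / ‖x - y‖ = x 0) ∧
    -- the potentials in space solve the aperture problem with Dirichlet data `1` and `x₁`
    EllipticAperture.SolvesApertureProblem (EllipticAperture.ellipticDisk a b)
      (fun _ => 1) (EllipticAperture.potW a b) ∧
    EllipticAperture.SolvesApertureProblem (EllipticAperture.ellipticDisk a b)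
      (fun y => y 0) (EllipticAperture.potT a b) ∧
    -- the energy of each potential in each of the two half-spaces
    (∀ U, U = EllipticAperture.upperHalfSpace ∨ U = EllipticAperture.lowerHalfSpace →
      EllipticAperture.HasDirichletEnergy (EllipticAperture.potW a b) U
        (4 * a * (EllipticAperture.ellipticK 0 /
          EllipticAperture.ellipticK (EllipticAperture.eccentricity a b))) ∧
      EllipticAperture.HasDirichletEnergy (EllipticAperture.potT a b) U
        (8 / 3 * a ^ 3 * (EllipticAperture.ellipticD 0 /
          EllipticAperture.ellipticD (EllipticAperture.eccentricity a b)))) := by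
  have ha : 0 < a := hb.trans_le hab
  exact ⟨fun x hx => ⟨(EllipticAperture.integrable_rhoW_div_norm ha hb hx).integrableOn,
      EllipticAperture.potential_rhoW hb hab hx⟩,
    fun x hx => ⟨(EllipticAperture.integrable_rhoT_div_norm ha hb hx).integrableOn,
      EllipticAperture.potential_rhoT hb hab hx⟩,
    EllipticAperture.solvesApertureProblem_potW hb hab,
    EllipticAperture.solvesApertureProblem_potT hb hab,
    fun U hU => ⟨EllipticAperture.hasDirichletEnergy_potW hb hab hU,
      EllipticAperture.hasDirichletEnergy_potT hb hab hU⟩⟩
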